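/- Let $K$ be a field. For a finite simple graph $G$ with vertex set $V$, let $J_G$ be its binomial edge ideal, i.e. the ideal of the standard graded polynomial ring $S=K[x_v,y_v : v\in V]$ generated by the binomials $x_iy_j-x_jy_i$ with $\{i,j\}$ an edge of $G$; let $\mathrm{reg}(J_G)=\max\{j-i : \beta_{i,j}(J_G)\neq 0\}$ be its Castelnuovo–Mumford regularity, where $\beta_{i,j}$ are the graded Betti numbers over $S$ (with $\mathrm{reg}(0)=-\infty$), and let $c(G)$ be the number of maximal cliques of $G$. We say that Conjecture B holds for $G$ (over $K$) if $\mathrm{reg}(J_G)\le c(G)+1$. A vertex is called free if it is contained in exactly one maximal clique. A free cut edge of $G$ is a cut edge $e$ of $G$ such that both endpoints of $e$ are free vertices of $G\setminus e$ (the graph on the same vertex set with the edge $e$ removed). The reduced graph $\mathcal{R}(G)$ is the graph on the vertex set $V$ obtained from $G$ by removing all free cut edges of $G$. **Theorem.** Let $G$ be a finite connected simple graph and let $R_1,\ldots,R_q$ be the connected components of $\mathcal{R}(G)$. If Conjecture B holds for each of $R_1,\ldots,R_q$, then it holds for $G$. -/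

import Mathlib

namespace BinomialEdge

open MvPolynomial

/-- A minimal graded free resolution
`⋯ → F₂ → F₁ → F₀ → I → 0` of an ideal `I` of the polynomial ring `S = K[σ]` with its standard
grading. The module `F i` is the graded free module `⨁ b, S(-deg i b)`: it has a basis indexed by
`Fin (rank i)` whose `b`-th element is homogeneous of degree `deg i b`. All maps are homogeneous of
degree `0`, the sequence is exact, and minimality says that the image of `F (i + 1)` lies in `𝔪 F i`,
where `𝔪` is the ideal generated by the variables. -/
structure MinimalGradedFreeResolution {σ K : Type*} [Field K] (I : Ideal (MvPolynomial σ K)) where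
  /-- the rank of the free module in homological degree `i` -/
  rank : ℕ → ℕ
  /-- the degrees of the basis elements -/
  deg : (i : ℕ) → Fin (rank i) → ℕ
  /-- the augmentation `F₀ → I ⊆ S` -/
  aug : (Fin (rank 0) → MvPolynomial σ K) →ₗ[MvPolynomial σ K] MvPolynomial σ K
  /-- the differentials `F (i + 1) → F i` -/
  d : (i : ℕ) → (Fin (rank (i + 1)) → MvPolynomial σ K) →ₗ[MvPolynomial σ K]
    (Fin (rank i) → MvPolynomial σ K)
  aug_homogeneous : ∀ b, (aug (Pi.single b 1)).IsHomogeneous (deg 0 b)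
  d_homogeneous : ∀ i b a, d i (Pi.single b 1) a ≠ 0 →
    ∃ k, k + deg i a = deg (i + 1) b ∧ (d i (Pi.single b 1) a).IsHomogeneous k
  range_aug : LinearMap.range aug = I
  exact_zero : LinearMap.range (d 0) = LinearMap.ker aug
  exact_succ : ∀ i, LinearMap.range (d (i + 1)) = LinearMap.ker (d i)
  minimal : ∀ i v a, constantCoeff (d i v a) = 0

/-- The number of basis elements of degree `j` of the `i`-th module of a resolution. -/
noncomputable def MinimalGradedFreeResolution.betti {σ K : Type*} [Field K] {I : Ideal (MvPolynomial σ K)}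
    (F : MinimalGradedFreeResolution I) (i j : ℕ) : ℕ :=
  Nat.card {b : Fin (F.rank i) // F.deg i b = j}

/-- The graded Betti number `β_{i,j}(I)`: the number of basis elements of degree `j` of the `i`-th
module of a minimal graded free resolution of `I`. Minimal graded free resolutions are unique up to
isomorphism, so the infimum is taken over a constant family. -/
noncomputable def gradedBetti {σ K : Type*} [Field K] (I : Ideal (MvPolynomial σ K)) (i j : ℕ) :
    ℕ∞ :=
  ⨅ F : MinimalGradedFreeResolution I, (F.betti i j : ℕ∞)

/-- The Castelnuovo–Mumford regularity `reg I = max {j - i : β_{i,j}(I) ≠ 0}`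
(with value `⊥` for `I = 0`). -/
noncomputable def regularity {σ K : Type*} [Field K] (I : Ideal (MvPolynomial σ K)) : EReal :=
  sSup {r : EReal | ∃ i j : ℕ, gradedBetti I i j ≠ 0 ∧ r = (((j : ℝ) - (i : ℝ) : ℝ) : EReal)}

/-- The binomial edge ideal `J_G ⊆ K[x_v, y_v : v ∈ V]`, generated by `x_i y_j - x_j y_i` for the
edges `{i, j}` of `G`. Here `x_v = X (Sum.inl v)` and `y_v = X (Sum.inr v)`. -/
noncomputable def binomialEdgeIdeal {V : Type*} (K : Type*) [Field K] (G : SimpleGraph V) :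
    Ideal (MvPolynomial (V ⊕ V) K) :=
  Ideal.span {f | ∃ i j : V, G.Adj i j ∧
    f = X (Sum.inl i) * X (Sum.inr j) - X (Sum.inl j) * X (Sum.inr i)}

/-- The number `c(G)` of maximal cliques (with respect to inclusion) of a finite graph. -/
noncomputable def numMaximalCliques {V : Type*} (G : SimpleGraph V) : ℕ :=
  {s : Set V | Maximal G.IsClique s}.ncard

/-- A free vertex: it is contained in exactly one maximal clique. -/
def IsFreeVertex {V : Type*} (G : SimpleGraph V) (v : V) : Prop :=
  ∃! s : Set V, Maximal G.IsClique s ∧ v ∈ s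

/-- A free cut edge: a cut edge `e` (an edge that is a bridge) whose endpoints are free vertices of
`G \ e`. -/
def IsFreeCutEdge {V : Type*} (G : SimpleGraph V) (e : Sym2 V) : Prop :=
  e ∈ G.edgeSet ∧ G.IsBridge e ∧ ∀ v ∈ e, IsFreeVertex (G.deleteEdges {e}) v

/-- The reduced graph `R(G)`: all free cut edges of `G` are removed, all vertices are kept. -/
def reducedGraph {V : Type*} (G : SimpleGraph V) : SimpleGraph V :=
  G.deleteEdges {e | IsFreeCutEdge G e}

/-- The inequality of Conjecture B for the graph `G` over the field `K`:
`reg J_G ≤ c(G) + 1`. -/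
def SatisfiesConjectureB {V : Type*} (K : Type*) [Field K] (G : SimpleGraph V) : Prop :=
  regularity (binomialEdgeIdeal K G) ≤ ((numMaximalCliques G + 1 : ℕ) : EReal)

end BinomialEdge

/-!
The regularity of `J_G` is at most `r + 1` exactly when `S ⧸ J_G` has a minimal graded free
resolution whose basis elements in homological degree `i` have degree at most `i + r`
(`HasResolutionLE`). Such resolutions are assembled from those of the components of the reduced
graph, with `r` counting maximal cliques with at least two vertices, and free cut edges.

* *Components.* The hypothesis provides, for each single graded Betti number, a minimal resolution
  in which it vanishes. Comparison of two minimal resolutions by chain maps and a homotopy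
  (`QuotientResolution.exists_same_degrees`) shows that one resolution then has all its degrees
  bounded. For a component without edges the ideal is zero and `r = 0`; for every other component
  each maximal clique has at least two vertices.
* *Disjoint unions.* The ideals of different components involve disjoint sets of variables, hence
  are Tor-independent (`QuotientResolution.torIndependent_baseChange`), and the total complex of
  the tensor product of the resolutions is a minimal resolution of the sum
  (`QuotientResolution.tensor`). So the bounds `r` add up.
* *Free cut edges.* Put the free cut edges back one at a time. The ends `i` and `j` of such an edge
  lie in different components of the graph `H` built so far, and have cliques as neighbourhoods.
  Then `x_i y_j - x_j y_i` is a nonzerodivisor modulo `J_H` (`mem_of_edgeBinomial_mul_mem`), and the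
  tensor product with the Koszul complex of this quadric raises `r` by one.
* *Counting.* The maximal cliques with at least two vertices of the components and the free cut
  edges are pairwise different maximal cliques of `G`
  (`sum_numNontrivialMaximalCliques_add_le`), because an edge on a triangle is not a bridge.

The nonzerodivisor statement rests on the `ℤ^V`-grading with `deg x_v = deg y_v = e_v`. Along a path
in the support of a multidegree `u` the Plücker relations
`x_a f_{kl} = x_k f_{al} + x_l f_{ka}` (and likewise for `y`) put into `J_H` every multiple of degree
`u` of the binomial of two connected vertices. So in degree `u` the ideal `J_H` is the kernel of the
substitution that identifies the vertices of each connected component of the subgraph induced on the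
support of `u` (`mem_of_rename_eq_zero`, `rename_component_eq_zero`). The target is a domain, and
adding to the support a vertex with a clique as neighbourhood does not merge components
(`reachable_of_reachable_insert`).
-/

namespace BinomialEdge

open MvPolynomial

/-! ### Minimal graded resolutions of quotient rings -/

/-- A minimal graded free resolution of `S ⧸ I`, for `S = K[σ]`, recorded on a single basis `B` of
`⨁ i, F i`: the basis element `b` lies in homological degree `hdeg b` and has internal degree
`deg b`, and `col b` is the value of the differential on it. Homological degree `0` is spanned by
`base`, which stands for `1 ∈ S`. Keeping all homological degrees in one module makes total
complexes free of dependent types. The field `exact` says at once that the homology vanishes in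
positive degrees and is at most `S ⧸ I` in degree `0`. -/
structure QuotientResolution {σ K : Type*} [Field K] (I : Ideal (MvPolynomial σ K)) where
  /-- the basis of the free module -/
  B : Type
  /-- the basis element in homological degree `0` -/
  base : B
  /-- the homological degree of a basis element -/
  hdeg : B → ℕ
  /-- the internal degree of a basis element -/
  deg : B → ℕ
  /-- the differential of a basis element -/
  col : B → (B →₀ MvPolynomial σ K)
  hdeg_eq_zero : ∀ b, hdeg b = 0 ↔ b = base
  deg_base : deg base = 0
  finite_fiber : ∀ n, {b | hdeg b = n}.Finite
  hdeg_col : ∀ b c, col b c ≠ 0 → hdeg b = hdeg c + 1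
  homog : ∀ b c, col b c ≠ 0 → ∃ k, k + deg c = deg b ∧ (col b c).IsHomogeneous k
  minimal : ∀ b c, constantCoeff (col b c) = 0
  d_col : ∀ b, Finsupp.linearCombination (MvPolynomial σ K) col (col b) = 0
  exact : ∀ z, Finsupp.linearCombination (MvPolynomial σ K) col z = 0 → z base ∈ I →
    ∃ u, Finsupp.linearCombination (MvPolynomial σ K) col u = z
  col_base_mem : ∀ b, col b base ∈ I

namespace QuotientResolution

variable {σ K : Type*} [Field K] {I : Ideal (MvPolynomial σ K)}

/-- The differential. -/
noncomputable def d (F : QuotientResolution I) :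
    (F.B →₀ MvPolynomial σ K) →ₗ[MvPolynomial σ K] (F.B →₀ MvPolynomial σ K) :=
  Finsupp.linearCombination (MvPolynomial σ K) F.col

lemma d_single (F : QuotientResolution I) (b : F.B) (s : MvPolynomial σ K) :
    F.d (Finsupp.single b s) = s • F.col b := by
  simp [d]

lemma d_eq_sum (F : QuotientResolution I) (z : F.B →₀ MvPolynomial σ K) :
    F.d z = z.sum fun b s => s • F.col b :=
  Finsupp.linearCombination_apply _ _

lemma d_apply (F : QuotientResolution I) (z : F.B →₀ MvPolynomial σ K) (c : F.B) :
    F.d z c = z.sum fun b s => s * F.col b c := by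
  simp [d, Finsupp.linearCombination_apply, Finsupp.sum]

lemma d_d (F : QuotientResolution I) (z : F.B →₀ MvPolynomial σ K) : F.d (F.d z) = 0 := by
  induction z using Finsupp.induction_linear with
  | zero => simp
  | add x y hx hy => simp [hx, hy]
  | single b s =>
    rw [d_single, map_smul]
    have := F.d_col b
    rw [show F.d (F.col b) = 0 from this, smul_zero]

lemma hdeg_base (F : QuotientResolution I) : F.hdeg F.base = 0 := (F.hdeg_eq_zero _).2 rfl

lemma col_base (F : QuotientResolution I) : F.col F.base = 0 := by
  ext1 c
  by_contra h
  have := F.hdeg_col _ _ h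
  rw [hdeg_base] at this
  omega

lemma d_base_mem (F : QuotientResolution I) (z : F.B →₀ MvPolynomial σ K) : F.d z F.base ∈ I := by
  rw [d_apply]
  exact I.sum_mem fun b _ => I.mul_mem_left _ (F.col_base_mem b)

/-- All basis elements `b` have internal degree at most `hdeg b + r`. -/
def DegLE (F : QuotientResolution I) (r : ℕ) : Prop := ∀ b, F.deg b ≤ F.hdeg b + r

end QuotientResolution

/-! ### Uniqueness of the degrees -/

/-- Maps out of a free module with a filtered basis may be chosen one basis element at a time. -/
lemma exists_family_of_step {R B M : Type*} [CommRing R] [AddCommGroup M] [Module R M]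
    (h : B → ℕ) (col : B → (B →₀ R)) (hcol : ∀ b c, col b c ≠ 0 → h c < h b)
    (P : B → M → M → Prop)
    (step : ∀ (T : B → M) (b : B),
      (∀ c, h c < h b → P c (Finsupp.linearCombination R T (col c)) (T c)) →
      ∃ y, P b (Finsupp.linearCombination R T (col b)) y) :
    ∃ T : B → M, ∀ b, P b (Finsupp.linearCombination R T (col b)) (T b) := by
  classical
  have wf : WellFounded (fun c b : B => h c < h b) := (measure h).wf
  let F : ∀ b, (∀ c, h c < h b → M) → M := fun b f =>
    if ex : ∃ y, P b (Finsupp.linearCombination R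
      (fun c => if hc : h c < h b then f c hc else 0) (col b)) y then ex.choose else 0
  let T : B → M := wf.fix F
  have key : ∀ b, Finsupp.linearCombination R
      (fun c => if _ : h c < h b then T c else 0) (col b) =
      Finsupp.linearCombination R T (col b) := by
    intro b
    rw [Finsupp.linearCombination_apply, Finsupp.linearCombination_apply]
    refine Finsupp.sum_congr fun c hc => ?_
    rw [dif_pos (hcol b c (Finsupp.mem_support_iff.1 hc))]
  refine ⟨T, fun b => ?_⟩
  induction b using wf.induction with
  | h b ih =>
  have ex := step T b ih
  rw [← key b] at ex
  have hT : T b = ex.choose := by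
    change wf.fix F b = _
    rw [wf.fix_eq]
    exact dif_pos ex
  rw [← key b, hT]
  exact ex.choose_spec

lemma homogeneousComponent_mul_of_isHomogeneous {σ K : Type*} [Field K] {q : MvPolynomial σ K}
    {m : ℕ} (hq : q.IsHomogeneous m) (s : MvPolynomial σ K) (t : ℕ) :
    homogeneousComponent t (s * q) =
      if m ≤ t then homogeneousComponent (t - m) s * q else 0 := by
  conv_lhs => rw [← sum_homogeneousComponent s, Finset.sum_mul, map_sum]
  have h1 : ∀ i, homogeneousComponent t (homogeneousComponent i s * q) =
      if t = i + m then homogeneousComponent i s * q else 0 := fun i =>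
    homogeneousComponent_of_mem ((homogeneousComponent_isHomogeneous i s).mul hq)
  simp only [h1]
  split_ifs with hm
  · have h2 : ∀ i, (t = i + m) ↔ i = t - m := by omega
    simp only [h2, Finset.sum_ite_eq', Finset.mem_range]
    split_ifs with h3
    · rfl
    · rw [homogeneousComponent_eq_zero _ _ (by omega), zero_mul]
  · exact Finset.sum_eq_zero fun i _ => if_neg (by omega)

namespace QuotientResolution

variable {σ K : Type*} [Field K] {I : Ideal (MvPolynomial σ K)}

/-- The coefficientwise part of `hproj`. -/
noncomputable def hcomp (F : QuotientResolution I) (n k : ℕ) (b : F.B) :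
    MvPolynomial σ K →+ MvPolynomial σ K :=
  open Classical in
  if F.hdeg b = n ∧ F.deg b ≤ k then
    (homogeneousComponent (k - F.deg b)).toAddMonoidHom else 0

/-- The projection onto the part of homological degree `n` and internal degree `k`. -/
noncomputable def hproj (F : QuotientResolution I) (n k : ℕ) :
    (F.B →₀ MvPolynomial σ K) →+ (F.B →₀ MvPolynomial σ K) :=
  Finsupp.liftAddHom fun b => (Finsupp.singleAddHom b).comp (F.hcomp n k b)

lemma hproj_single (F : QuotientResolution I) (n k : ℕ) (b : F.B) (s : MvPolynomial σ K) :
    F.hproj n k (Finsupp.single b s) = Finsupp.single b (F.hcomp n k b s) := by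
  simp [hproj]

lemma hproj_apply (F : QuotientResolution I) (n k : ℕ) (z : F.B →₀ MvPolynomial σ K) (c : F.B) :
    F.hproj n k z c = F.hcomp n k c (z c) := by
  classical
  induction z using Finsupp.induction_linear with
  | zero => simp
  | add x y hx hy => simp [hx, hy]
  | single b s =>
    rw [hproj_single]
    by_cases h : b = c
    · subst h; simp
    · simp [h]

lemma d_hproj (F : QuotientResolution I) (n k : ℕ) (u : F.B →₀ MvPolynomial σ K) :
    F.d (F.hproj (n + 1) k u) = F.hproj n k (F.d u) := by
  induction u using Finsupp.induction_linear with
  | zero => simp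
  | add x y hx hy => simp [hx, hy]
  | single b s =>
    ext1 c
    rw [hproj_single, d_single, d_single, hproj_apply, Finsupp.smul_apply, Finsupp.smul_apply,
      smul_eq_mul, smul_eq_mul]
    by_cases h0 : F.col b c = 0
    · simp [h0]
    have h1 := F.hdeg_col b c h0
    obtain ⟨m, hm, hq⟩ := F.homog b c h0
    unfold hcomp
    by_cases h2 : F.hdeg c = n
    · by_cases h3 : F.deg c ≤ k
      · rw [if_pos (show F.hdeg c = n ∧ F.deg c ≤ k from ⟨h2, h3⟩)]
        simp only [LinearMap.toAddMonoidHom_coe]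
        rw [homogeneousComponent_mul_of_isHomogeneous hq]
        by_cases h4 : F.deg b ≤ k
        · rw [if_pos ⟨by omega, h4⟩, if_pos (by omega)]
          simp only [LinearMap.toAddMonoidHom_coe]
          rw [show k - F.deg c - m = k - F.deg b by omega]
        · rw [if_neg (by omega), if_neg (by omega)]
          simp
      · rw [if_neg (by omega), if_neg (by omega)]
        simp
    · rw [if_neg (by omega), if_neg (by omega)]
      simp

lemma hproj_spec (F : QuotientResolution I) (n k : ℕ) (u : F.B →₀ MvPolynomial σ K) (c : F.B)
    (hc : F.hproj n k u c ≠ 0) :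
    F.hdeg c = n ∧ ∃ m, m + F.deg c = k ∧ (F.hproj n k u c).IsHomogeneous m := by
  rw [hproj_apply] at hc ⊢
  unfold hcomp at hc ⊢
  split_ifs at hc ⊢ with h
  · exact ⟨h.1, k - F.deg c, by omega, homogeneousComponent_isHomogeneous _ _⟩
  · simp at hc

/-- The lift of the identity of `S ⧸ I` to a homogeneous chain map between two resolutions. -/
lemma exists_homogeneous_chainMap (F G : QuotientResolution I) :
    ∃ T : F.B → (G.B →₀ MvPolynomial σ K),
      (∀ b, G.d (T b) = Finsupp.linearCombination (MvPolynomial σ K) T (F.col b)) ∧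
      T F.base = Finsupp.single G.base 1 ∧
      ∀ b c, T b c ≠ 0 → G.hdeg c = F.hdeg b ∧
        ∃ k, k + G.deg c = F.deg b ∧ (T b c).IsHomogeneous k := by
  classical
  obtain ⟨T, hT⟩ := exists_family_of_step (R := MvPolynomial σ K)
    (M := G.B →₀ MvPolynomial σ K) F.hdeg F.col
    (fun b c hbc => by have := F.hdeg_col b c hbc; omega)
    (fun b y v => G.d v = y ∧ (b = F.base → v = Finsupp.single G.base 1) ∧
      ∀ c, v c ≠ 0 → G.hdeg c = F.hdeg b ∧ ∃ k, k + G.deg c = F.deg b ∧ (v c).IsHomogeneous k)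
    (by
      intro T b ih
      by_cases hb : b = F.base
      · subst hb
        refine ⟨Finsupp.single G.base 1, ?_, fun _ => rfl, fun c hc => ?_⟩
        · simp [d_single, col_base]
        · rw [Finsupp.single_apply] at hc
          split_ifs at hc with h
          · subst h
            refine ⟨by rw [hdeg_base, hdeg_base], 0, by rw [G.deg_base, F.deg_base], ?_⟩
            simpa using isHomogeneous_one _ _
          · exact absurd rfl hc
      · set y := Finsupp.linearCombination (MvPolynomial σ K) T (F.col b) with hy
        obtain ⟨n, hn⟩ : ∃ n, F.hdeg b = n + 1 :=
          Nat.exists_eq_succ_of_ne_zero fun h => hb ((F.hdeg_eq_zero b).1 h)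
        have hy_apply : ∀ c, y c = ∑ e ∈ (F.col b).support, F.col b e * T e c := by
          intro c
          simp [hy, Finsupp.linearCombination_apply, Finsupp.sum]
        have hlow : ∀ e ∈ (F.col b).support, F.hdeg e = n := fun e he => by
          have := F.hdeg_col b e (Finsupp.mem_support_iff.1 he); omega
        have hdy : G.d y = 0 := by
          have h1 : G.d y = Finsupp.linearCombination (MvPolynomial σ K) T (F.d (F.col b)) := by
            rw [hy, Finsupp.linearCombination_apply, Finsupp.sum, map_sum, d_eq_sum, Finsupp.sum,
              map_sum]
            refine Finset.sum_congr rfl fun e he => ?_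
            rw [map_smul, map_smul, ← (ih e (by have := hlow e he; omega)).1]
          rw [h1, show F.d (F.col b) = 0 from F.d_col b, map_zero]
        have hyI : y G.base ∈ I := by
          rw [hy_apply]
          refine I.sum_mem fun e he => ?_
          by_cases h0 : T e G.base = 0
          · simp [h0]
          · have h2 := ((ih e (by have := hlow e he; omega)).2.2 _ h0).1
            rw [hdeg_base] at h2
            rw [(F.hdeg_eq_zero e).1 h2.symm]
            exact I.mul_mem_right _ (F.col_base_mem b)
        obtain ⟨u, hu⟩ := G.exact y hdy hyI
        have hproj_y : G.hproj n (F.deg b) y = y := by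
          ext1 c
          rw [hproj_apply]
          unfold hcomp
          have hterm : ∀ e ∈ (F.col b).support, F.col b e * T e c ≠ 0 →
              G.hdeg c = n ∧ G.deg c ≤ F.deg b ∧
                (F.col b e * T e c).IsHomogeneous (F.deg b - G.deg c) := by
            intro e he hne
            have h1 := hlow e he
            obtain ⟨h2, k, hk, hk'⟩ := (ih e (by omega)).2.2 c (right_ne_zero_of_mul hne)
            obtain ⟨m, hm, hm'⟩ := F.homog b e (left_ne_zero_of_mul hne)
            refine ⟨by omega, by omega, ?_⟩
            rw [show F.deg b - G.deg c = m + k by omega]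
            exact hm'.mul hk'
          split_ifs with h
          · refine homogeneousComponent_eq_self ?_
            rw [hy_apply]
            refine IsHomogeneous.sum _ _ _ fun e he => ?_
            by_cases h0 : F.col b e * T e c = 0
            · rw [h0]; exact isHomogeneous_zero _ _ _
            · exact (hterm e he h0).2.2
          · rw [hy_apply]
            refine (Finset.sum_eq_zero fun e he => ?_).symm
            by_contra h0
            have := hterm e he h0
            exact h ⟨this.1, this.2.1⟩
        refine ⟨G.hproj (n + 1) (F.deg b) u, ?_, fun h => absurd h hb, fun c hc => ?_⟩
        · rw [d_hproj]
          rw [show G.d u = y from hu, hproj_y]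
        · have := G.hproj_spec _ _ _ _ hc
          rw [hn]; exact this)
  exact ⟨T, fun b => (hT b).1, (hT _).2.1 rfl, fun b => (hT b).2.2⟩

/-- A chain map from a resolution of `S ⧸ I` to itself lifting the identity is homotopic to the
identity. By minimality it is the identity modulo the ideal of the variables. -/
lemma constantCoeff_chainMap_self (F : QuotientResolution I)
    (Φ : (F.B →₀ MvPolynomial σ K) →ₗ[MvPolynomial σ K] (F.B →₀ MvPolynomial σ K))
    (hΦ : ∀ z, F.d (Φ z) = Φ (F.d z)) (hbase : ∀ z, Φ z F.base = z F.base) (b : F.B) :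
    constantCoeff (Φ (Finsupp.single b 1) b) = 1 := by
  classical
  obtain ⟨T, hT⟩ := exists_family_of_step (R := MvPolynomial σ K)
    (M := F.B →₀ MvPolynomial σ K) F.hdeg F.col
    (fun b c hbc => by have := F.hdeg_col b c hbc; omega)
    (fun b y v => F.d v = Φ (Finsupp.single b 1) - Finsupp.single b 1 - y ∧ v F.base = 0)
    (by
      intro T b ih
      set y := Finsupp.linearCombination (MvPolynomial σ K) T (F.col b) with hy
      have hdy : F.d y = Φ (F.col b) - F.col b := by
        have h1 : F.d y = (F.col b).sum fun c s => s • (Φ (Finsupp.single c 1) -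
            Finsupp.single c 1 - Finsupp.linearCombination (MvPolynomial σ K) T (F.col c)) := by
          rw [hy, Finsupp.linearCombination_apply, Finsupp.sum, map_sum]
          refine Finset.sum_congr rfl fun e he => ?_
          rw [map_smul]
          have := F.hdeg_col b e (Finsupp.mem_support_iff.1 he)
          rw [(ih e (by omega)).1]
        have h2 : ∀ z : F.B →₀ MvPolynomial σ K, (z.sum fun c s => s • (Φ (Finsupp.single c 1) -
            Finsupp.single c 1 - Finsupp.linearCombination (MvPolynomial σ K) T (F.col c))) =
            Φ z - z - Finsupp.linearCombination (MvPolynomial σ K) T (F.d z) := by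
          intro z
          induction z using Finsupp.induction_linear with
          | zero => simp
          | add f g hf hg =>
            rw [Finsupp.sum_add_index' (by simp) (by intros; rw [add_smul]), hf, hg]
            simp only [map_add]
            abel
          | single c s =>
            rw [Finsupp.sum_single_index (by simp), d_single, map_smul, smul_sub, smul_sub,
              ← map_smul]
            simp
        rw [h1, h2, show F.d (F.col b) = 0 from F.d_col b]
        simp
      obtain ⟨u, hu⟩ := F.exact (Φ (Finsupp.single b 1) - Finsupp.single b 1 - y)
        (by
          change F.d _ = 0
          rw [map_sub, map_sub, hdy, hΦ, d_single]
          simp)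
        (by
          rw [Finsupp.sub_apply, Finsupp.sub_apply, hbase, sub_self, zero_sub]
          refine I.neg_mem ?_
          rw [hy, Finsupp.linearCombination_apply, Finsupp.sum, Finsupp.finsetSum_apply]
          refine I.sum_mem fun e he => ?_
          have := F.hdeg_col b e (Finsupp.mem_support_iff.1 he)
          rw [Finsupp.smul_apply, (ih e (by omega)).2]
          simp)
      -- the differential vanishes on `base`, so that coordinate of the homotopy may be dropped
      refine ⟨u.erase F.base, ?_, by simp⟩
      rw [← hu]
      change F.d _ = F.d _
      conv_rhs => rw [← Finsupp.single_add_erase F.base u]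
      rw [map_add, d_single, col_base, smul_zero, zero_add])
  have h1 := congrArg (fun z => constantCoeff (z b)) (hT b).1
  simp only [Finsupp.sub_apply, map_sub, Finsupp.single_eq_same, map_one] at h1
  have h2 : constantCoeff (F.d (T b) b) = 0 := by
    rw [d_apply, Finsupp.sum, map_sum]
    exact Finset.sum_eq_zero fun c _ => by rw [map_mul, F.minimal, mul_zero]
  have h3 : constantCoeff (Finsupp.linearCombination (MvPolynomial σ K) T (F.col b) b) = 0 := by
    rw [Finsupp.linearCombination_apply, Finsupp.sum, Finsupp.finsetSum_apply, map_sum]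
    exact Finset.sum_eq_zero fun c _ => by
      rw [Finsupp.smul_apply, smul_eq_mul, map_mul, F.minimal, zero_mul]
  rw [h2, h3] at h1
  linear_combination -h1

/-- Two minimal graded resolutions of the same quotient have basis elements in the same degrees:
the composite of the two comparison maps is the identity modulo the variables, so a basis element
has to pass, with a nonzero constant coefficient, through one of the same degrees. -/
theorem exists_same_degrees (F G : QuotientResolution I) (b : F.B) :
    ∃ c : G.B, G.hdeg c = F.hdeg b ∧ G.deg c = F.deg b := by
  obtain ⟨T, hT, hT0, hTdeg⟩ := exists_homogeneous_chainMap F G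
  obtain ⟨U, hU, hU0, hUdeg⟩ := exists_homogeneous_chainMap G F
  have comm : ∀ {F G : QuotientResolution I} {T : F.B → (G.B →₀ MvPolynomial σ K)},
      (∀ b, G.d (T b) = Finsupp.linearCombination (MvPolynomial σ K) T (F.col b)) →
      ∀ z, G.d (Finsupp.linearCombination (MvPolynomial σ K) T z) =
        Finsupp.linearCombination (MvPolynomial σ K) T (F.d z) := by
    intro F G T hT z
    induction z using Finsupp.induction_linear with
    | zero => simp
    | add x y hx hy => simp [hx, hy]
    | single b s => simp [d_single, hT]
  have base : ∀ {F G : QuotientResolution I} {T : F.B → (G.B →₀ MvPolynomial σ K)},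
      T F.base = Finsupp.single G.base 1 →
      (∀ b c, T b c ≠ 0 → G.hdeg c = F.hdeg b ∧
        ∃ k, k + G.deg c = F.deg b ∧ (T b c).IsHomogeneous k) →
      ∀ z, Finsupp.linearCombination (MvPolynomial σ K) T z G.base = z F.base := by
    intro F G T h0 hdeg z
    induction z using Finsupp.induction_linear with
    | zero => simp
    | add x y hx hy => simp [hx, hy]
    | single b s =>
      rw [Finsupp.linearCombination_single, Finsupp.smul_apply, smul_eq_mul]
      by_cases hb : b = F.base
      · subst hb; simp [h0]
      · have : T b G.base = 0 := by
          by_contra h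
          have h2 := (hdeg _ _ h).1
          rw [hdeg_base] at h2
          exact hb ((F.hdeg_eq_zero b).1 h2.symm)
        rw [this, Finsupp.single_eq_of_ne (Ne.symm hb), mul_zero]
  have key := constantCoeff_chainMap_self F
    ((Finsupp.linearCombination (MvPolynomial σ K) U).comp
      (Finsupp.linearCombination (MvPolynomial σ K) T))
    (fun z => by rw [LinearMap.comp_apply, LinearMap.comp_apply, comm hU, comm hT])
    (fun z => by rw [LinearMap.comp_apply, base hU0 hUdeg, base hT0 hTdeg]) b
  rw [LinearMap.comp_apply, Finsupp.linearCombination_single, one_smul,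
    Finsupp.linearCombination_apply, Finsupp.sum, Finsupp.finsetSum_apply, map_sum] at key
  obtain ⟨c, -, hc⟩ := Finset.exists_ne_zero_of_sum_ne_zero (key ▸ one_ne_zero)
  rw [Finsupp.smul_apply, smul_eq_mul, map_mul] at hc
  have h1 := left_ne_zero_of_mul hc
  obtain ⟨h2, k, hk, hk'⟩ := hTdeg b c (fun h => h1 (by rw [h, map_zero]))
  refine ⟨c, h2, ?_⟩
  have : k = 0 := by
    by_contra h0
    exact h1 (hk'.coeff_eq_zero (d := 0) (by simpa using Ne.symm h0))
  omega

end QuotientResolution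

/-! ### Tensor products of resolutions -/

namespace QuotientResolution

variable {σ K : Type*} [Field K] {I J : Ideal (MvPolynomial σ K)}

/-- The homology of `F ⊗ S ⧸ J` vanishes in positive degrees. Together with right exactness, this
is the vanishing of `Tor_i(S ⧸ I, S ⧸ J)` for `i > 0`. -/
def TorIndependent (F : QuotientResolution I) (J : Ideal (MvPolynomial σ K)) : Prop :=
  ∀ y : F.B →₀ MvPolynomial σ K, (∀ b, F.d y b ∈ J) → y F.base ∈ I ⊔ J →
    ∃ u, ∀ b, y b - F.d u b ∈ J

/-- The part of homological degree `n` of a vector. -/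
noncomputable def part (F : QuotientResolution I) (n : ℕ) (z : F.B →₀ MvPolynomial σ K) :
    F.B →₀ MvPolynomial σ K :=
  z.filter fun b => F.hdeg b = n

lemma part_apply (F : QuotientResolution I) (n : ℕ) (z : F.B →₀ MvPolynomial σ K) (b : F.B) :
    F.part n z b = if F.hdeg b = n then z b else 0 :=
  Finsupp.filter_apply _ _ _

lemma d_apply_part (F : QuotientResolution I) (n : ℕ) (z : F.B →₀ MvPolynomial σ K) (c : F.B) :
    F.d (F.part (n + 1) z) c = if F.hdeg c = n then F.d z c else 0 := by
  have key : F.d (F.part (n + 1) z) = F.part n (F.d z) := by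
    unfold part
    induction z using Finsupp.induction_linear with
    | zero => rw [Finsupp.filter_zero, map_zero, Finsupp.filter_zero]
    | add x y hx hy => rw [Finsupp.filter_add, map_add, map_add, hx, hy, Finsupp.filter_add]
    | single b s =>
      change F.d (F.part (n + 1) (Finsupp.single b s)) = F.part n (F.d (Finsupp.single b s))
      have h1 : F.part (n + 1) (Finsupp.single b s) =
          if F.hdeg b = n + 1 then Finsupp.single b s else 0 := by
        unfold part
        split_ifs with h
        · exact Finsupp.filter_single_of_pos _ h
        · exact Finsupp.filter_single_of_neg _ h
      ext1 c
      rw [h1, part_apply, apply_ite F.d, d_single, map_zero]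
      by_cases h0 : F.col b c = 0
      · split_ifs <;> simp [h0]
      · have := F.hdeg_col b c h0
        split_ifs
        · rfl
        · omega
        · omega
        · rfl
  rw [key, part_apply]

lemma d_apply_eq_zero (F : QuotientResolution I) (z : F.B →₀ MvPolynomial σ K) (c : F.B)
    (h : ∀ b, F.hdeg b = F.hdeg c + 1 → z b = 0) : F.d z c = 0 := by
  rw [d_apply]
  refine Finset.sum_eq_zero fun b _ => ?_
  change z b * F.col b c = 0
  by_cases h0 : F.col b c = 0
  · rw [h0, mul_zero]
  · rw [h b (F.hdeg_col b c h0), zero_mul]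

/-- The restriction of a vector on `B × B'` to `B × {b'}`. -/
noncomputable def slice {B B' R : Type*} [CommRing R] (b' : B') : (B × B' →₀ R) →ₗ[R] (B →₀ R) :=
  Finsupp.lcomapDomain (fun b => (b, b')) (fun _ _ h => congrArg Prod.fst h)

@[simp] lemma slice_apply {B B' R : Type*} [CommRing R] (b' : B') (z : B × B' →₀ R) (b : B) :
    slice b' z b = z (b, b') := rfl

/-- The restriction of a vector on `B × B'` to `{b} × B'`. -/
noncomputable def coslice {B B' R : Type*} [CommRing R] (b : B) :
    (B × B' →₀ R) →ₗ[R] (B' →₀ R) :=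
  Finsupp.lcomapDomain (fun b' => (b, b')) (fun _ _ h => congrArg Prod.snd h)

@[simp] lemma coslice_apply {B B' R : Type*} [CommRing R] (b : B) (z : B × B' →₀ R) (b' : B') :
    coslice b z b' = z (b, b') := rfl

lemma mapDomain_prodMk_right {B B' R : Type*} [CommRing R] [DecidableEq B'] (f : B →₀ R)
    (a' : B') (b : B) (b' : B') :
    Finsupp.mapDomain (fun a => (a, a')) f (b, b') = if a' = b' then f b else 0 := by
  split_ifs with h
  · subst h
    exact Finsupp.mapDomain_apply (f := fun a => (a, a')) (fun _ _ h => congrArg Prod.fst h) f b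
  · refine Finsupp.mapDomain_of_notMem_range _ _ ?_
    rintro ⟨a, ha⟩
    exact h (congrArg Prod.snd ha)

lemma mapDomain_prodMk_left {B B' R : Type*} [CommRing R] [DecidableEq B] (f : B' →₀ R)
    (a : B) (b : B) (b' : B') :
    Finsupp.mapDomain (fun a' => (a, a')) f (b, b') = if a = b then f b' else 0 := by
  split_ifs with h
  · subst h
    exact Finsupp.mapDomain_apply (f := fun a' => (a, a')) (fun _ _ h => congrArg Prod.snd h) f b'
  · refine Finsupp.mapDomain_of_notMem_range _ _ ?_
    rintro ⟨a, ha⟩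
    exact h (congrArg Prod.fst ha)

/-- The differential `∂(b ⊗ b') = ∂b ⊗ b' + (-1)^|b| b ⊗ ∂b'` of the total complex. -/
noncomputable def tensorCol (F : QuotientResolution I) (G : QuotientResolution J)
    (p : F.B × G.B) : F.B × G.B →₀ MvPolynomial σ K :=
  Finsupp.mapDomain (fun a => (a, p.2)) (F.col p.1) +
    (-1 : MvPolynomial σ K) ^ F.hdeg p.1 • Finsupp.mapDomain (fun a' => (p.1, a')) (G.col p.2)

lemma tensorCol_apply (F : QuotientResolution I)
    (G : QuotientResolution J) [DecidableEq F.B] [DecidableEq G.B] (a b : F.B) (a' b' : G.B) :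
    tensorCol F G (a, a') (b, b') = (if a' = b' then F.col a b else 0) +
      (-1) ^ F.hdeg a * (if a = b then G.col a' b' else 0) := by
  rw [tensorCol, Finsupp.add_apply, Finsupp.smul_apply, mapDomain_prodMk_right,
    mapDomain_prodMk_left, smul_eq_mul]

/-- The differential of the total complex. -/
noncomputable def tensorD (F : QuotientResolution I) (G : QuotientResolution J) :
    (F.B × G.B →₀ MvPolynomial σ K) →ₗ[MvPolynomial σ K] (F.B × G.B →₀ MvPolynomial σ K) :=
  Finsupp.linearCombination (MvPolynomial σ K) (tensorCol F G)

lemma tensorD_apply (F : QuotientResolution I) (G : QuotientResolution J)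
    (z : F.B × G.B →₀ MvPolynomial σ K) (b : F.B) (b' : G.B) :
    tensorD F G z (b, b') =
      F.d (slice b' z) b + (-1) ^ F.hdeg b * G.d (coslice b z) b' := by
  classical
  induction z using Finsupp.induction_linear with
  | zero => simp
  | add x y hx hy => simp only [map_add, Finsupp.add_apply, hx, hy]; ring
  | single a s =>
    obtain ⟨a, a'⟩ := a
    have h1 : slice b' (Finsupp.single (a, a') s) = if a' = b' then Finsupp.single a s else 0 := by
      ext1 c
      by_cases h : a' = b' <;> by_cases h' : a = c <;> simp [h, h']
    have h2 : coslice b (Finsupp.single (a, a') s) = if a = b then Finsupp.single a' s else 0 := by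
      ext1 c
      by_cases h : a = b <;> by_cases h' : a' = c <;> simp [h, h']
    rw [h1, h2, tensorD, Finsupp.linearCombination_single, Finsupp.smul_apply, tensorCol_apply]
    by_cases h : a' = b' <;> by_cases h' : a = b <;> simp [h, h', d_single, mul_add]
    all_goals ring

lemma tensorD_base_mem (F : QuotientResolution I) (G : QuotientResolution J)
    (z : F.B × G.B →₀ MvPolynomial σ K) : tensorD F G z (F.base, G.base) ∈ I ⊔ J := by
  rw [tensorD_apply]
  exact add_mem (Ideal.mem_sup_left (F.d_base_mem _))
    (Ideal.mul_mem_left _ _ (Ideal.mem_sup_right (G.d_base_mem _)))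

lemma tensorD_tensorCol (F : QuotientResolution I) (G : QuotientResolution J) (p : F.B × G.B) :
    tensorD F G (tensorCol F G p) = 0 := by
  classical
  obtain ⟨a, a'⟩ := p
  ext1 q
  obtain ⟨b, b'⟩ := q
  have h1 : slice b' (tensorCol F G (a, a')) = (if a' = b' then F.col a else 0) +
      Finsupp.single a ((-1) ^ F.hdeg a * G.col a' b') := by
    ext1 c
    rw [slice_apply, tensorCol_apply]
    by_cases h : a' = b' <;> by_cases h' : a = c <;> simp [h, h']
  have h2 : coslice b (tensorCol F G (a, a')) = Finsupp.single a' (F.col a b) +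
      if a = b then (-1 : MvPolynomial σ K) ^ F.hdeg a • G.col a' else 0 := by
    ext1 c
    rw [coslice_apply, tensorCol_apply]
    by_cases h : a' = c <;> by_cases h' : a = b <;> simp [h, h']
  have h3 : F.d (F.col a) = 0 := F.d_col a
  have h4 : G.d (G.col a') = 0 := G.d_col a'
  have h5 : F.d (if a' = b' then F.col a else 0) = 0 := by split_ifs <;> simp [h3]
  have h6 : G.d (if a = b then (-1 : MvPolynomial σ K) ^ F.hdeg a • G.col a' else 0) = 0 := by
    split_ifs <;> simp [h4]
  rw [tensorD_apply, h1, h2, map_add, map_add, h5, h6, d_single, d_single, zero_add, add_zero,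
    Finsupp.smul_apply, Finsupp.smul_apply, smul_eq_mul, smul_eq_mul, Finsupp.zero_apply]
  by_cases h0 : F.col a b = 0
  · simp [h0]
  · rw [F.hdeg_col a b h0, pow_succ]
    ring

/-- A cycle of the total complex is a boundary: its part of largest degree in the first factor is
removed first modulo `J`, by Tor-independence, then completely, by the exactness of `G`. -/
lemma tensor_exact (F : QuotientResolution I) (G : QuotientResolution J)
    (hTor : F.TorIndependent J) (n : ℕ) :
    ∀ z, (∀ b b', z (b, b') ≠ 0 → F.hdeg b < n) → tensorD F G z = 0 →
      z (F.base, G.base) ∈ I ⊔ J → ∃ u, tensorD F G u = z := by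
  classical
  induction n with
  | zero =>
    intro z hz _ _
    refine ⟨0, ?_⟩
    rw [map_zero]
    ext1 ⟨b, b'⟩
    by_contra h
    exact absurd (hz b b' (Ne.symm h)) (by omega)
  | succ p ih =>
    intro z hz hdz hzI
    have dd : ∀ w, tensorD F G (tensorD F G w) = 0 := by
      intro w
      induction w using Finsupp.induction_linear with
      | zero => simp
      | add x y hx hy => simp [hx, hy]
      | single b s =>
        have : tensorD F G (Finsupp.single b s) = s • tensorCol F G b := by simp [tensorD]
        rw [this, map_smul, tensorD_tensorCol, smul_zero]
    -- the part in `F_p ⊗ G_0` is a cycle modulo `J`, so a boundary clears it modulo `J`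
    obtain ⟨u0, hu0⟩ := hTor (F.part p (slice G.base z))
      (by
        intro c
        by_cases hc : F.hdeg c + 1 = p
        · have h1 : (F.part p (slice G.base z)) =
              F.part (F.hdeg c + 1) (slice G.base z) := by rw [hc]
          rw [h1, d_apply_part, if_pos rfl]
          have h2 := DFunLike.congr_fun hdz (c, G.base)
          rw [tensorD_apply, Finsupp.zero_apply] at h2
          rw [eq_neg_of_add_eq_zero_left h2]
          exact J.neg_mem (J.mul_mem_left _ (G.d_base_mem _))
        · rw [d_apply_eq_zero]
          · exact J.zero_mem
          · intro b hb
            rw [part_apply, if_neg (by omega)])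
      (by
        by_cases h : F.hdeg F.base = p
        · rw [part_apply, if_pos h]
          exact hzI
        · rw [part_apply, if_neg h]
          exact zero_mem _)
    set u := F.part (p + 1) u0 with hu
    set U : F.B × G.B →₀ MvPolynomial σ K := Finsupp.mapDomain (fun a => (a, G.base)) u with hU
    have hdU : ∀ c c', tensorD F G U (c, c') =
        if F.hdeg c = p ∧ c' = G.base then F.d u0 c else 0 := by
      intro c c'
      have h1 : slice c' U = if c' = G.base then u else 0 := by
        ext1 b
        rw [slice_apply, hU, mapDomain_prodMk_right]
        by_cases h : c' = G.base <;> simp [h, eq_comm]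
      have h2 : coslice c U = Finsupp.single G.base (u c) := by
        ext1 b'
        rw [coslice_apply, hU, mapDomain_prodMk_right, Finsupp.single_apply]
      rw [tensorD_apply, h1, h2, d_single, col_base, smul_zero, Finsupp.zero_apply, mul_zero,
        add_zero]
      by_cases h : c' = G.base
      · simp [h, hu, d_apply_part]
      · simp [h]
    set z1 := z - tensorD F G U with hz1
    have hz1_top : ∀ b b', p < F.hdeg b → z1 (b, b') = 0 := by
      intro b b' hb
      rw [hz1, Finsupp.sub_apply, hdU, if_neg (by omega), sub_zero]
      by_contra h
      have := hz b b' h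
      omega
    have hdz1 : tensorD F G z1 = 0 := by rw [hz1, map_sub, hdz, dd, sub_zero]
    have hz1J : ∀ b, F.hdeg b = p → z1 (b, G.base) ∈ J := by
      intro b hb
      rw [hz1, Finsupp.sub_apply, hdU, if_pos ⟨hb, rfl⟩]
      have := hu0 b
      rwa [part_apply, if_pos hb, slice_apply] at this
    -- the part in `F_p ⊗ G` is now, for each basis element of `F_p`, a boundary of `G`
    have hex : ∀ b, ∃ w, F.hdeg b = p → G.d w = coslice b z1 := by
      intro b
      by_cases hb : F.hdeg b = p
      · have h1 : G.d (coslice b z1) = 0 := by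
          ext1 b'
          have h2 := DFunLike.congr_fun hdz1 (b, b')
          rw [tensorD_apply, Finsupp.zero_apply, d_apply_eq_zero, zero_add] at h2
          · rw [Finsupp.zero_apply]
            exact (mul_eq_zero.1 h2).resolve_left (pow_ne_zero _ (neg_ne_zero.2 one_ne_zero))
          · intro c hc
            exact hz1_top c b' (by omega)
        obtain ⟨w, hw⟩ := G.exact _ h1 (hz1J b hb)
        exact ⟨w, fun _ => hw⟩
      · exact ⟨0, fun h => absurd h hb⟩
    choose w hw using hex
    set W : F.B × G.B →₀ MvPolynomial σ K := ∑ b ∈ (F.finite_fiber p).toFinset,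
      (-1 : MvPolynomial σ K) ^ p • Finsupp.mapDomain (fun a' => (b, a')) (w b) with hW
    have hW_apply : ∀ c c', W (c, c') = if F.hdeg c = p then (-1) ^ p * w c c' else 0 := by
      intro c c'
      rw [hW, Finsupp.finsetSum_apply]
      simp only [Finsupp.smul_apply, mapDomain_prodMk_left, smul_eq_mul, mul_ite, mul_zero]
      rw [Finset.sum_ite_eq']
      simp
    have hdW : ∀ c c', p ≤ F.hdeg c → tensorD F G W (c, c') =
        if F.hdeg c = p then z1 (c, c') else 0 := by
      intro c c' hc
      rw [tensorD_apply, d_apply_eq_zero, zero_add]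
      · by_cases h : F.hdeg c = p
        · have h1 : coslice c W = (-1 : MvPolynomial σ K) ^ p • w c := by
            ext1 b'
            rw [coslice_apply, hW_apply, if_pos h]
            rfl
          rw [h1, map_smul, hw c h, if_pos h, h, Finsupp.smul_apply, smul_eq_mul, ← mul_assoc,
            ← mul_pow]
          simp
        · have h1 : coslice c W = 0 := by
            ext1 b'
            rw [coslice_apply, hW_apply, if_neg h]
            rfl
          rw [h1, if_neg h]
          simp
      · intro b hb
        rw [slice_apply, hW_apply, if_neg (by omega)]
    obtain ⟨v, hv⟩ := ih (z1 - tensorD F G W)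
      (by
        intro b b' hne
        by_contra hlt
        apply hne
        rw [Finsupp.sub_apply, hdW b b' (by omega)]
        split_ifs with h
        · rw [sub_self]
        · rw [hz1_top b b' (by omega), sub_zero])
      (by rw [map_sub, hdz1, dd, sub_zero])
      (by
        rw [Finsupp.sub_apply, hz1, Finsupp.sub_apply]
        exact sub_mem (sub_mem hzI (tensorD_base_mem F G _)) (tensorD_base_mem F G _))
    refine ⟨v + W + U, ?_⟩
    rw [map_add, map_add, hv, hz1]
    abel

/-- The total complex of the tensor product of Tor-independent resolutions. -/
noncomputable def tensor (F : QuotientResolution I) (G : QuotientResolution J)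
    (hTor : F.TorIndependent J) : QuotientResolution (I ⊔ J) where
  B := F.B × G.B
  base := (F.base, G.base)
  hdeg p := F.hdeg p.1 + G.hdeg p.2
  deg p := F.deg p.1 + G.deg p.2
  col := tensorCol F G
  hdeg_eq_zero := by
    rintro ⟨b, b'⟩
    rw [Nat.add_eq_zero_iff, F.hdeg_eq_zero, G.hdeg_eq_zero, Prod.mk.injEq]
  deg_base := by rw [F.deg_base, G.deg_base]
  finite_fiber n := by
    have h1 : {b | F.hdeg b ≤ n}.Finite := by
      have : {b | F.hdeg b ≤ n} = ⋃ i ∈ Set.Iic n, {b | F.hdeg b = i} := by ext; simp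
      rw [this]
      exact (Set.finite_Iic n).biUnion fun i _ => F.finite_fiber i
    have h2 : {b | G.hdeg b ≤ n}.Finite := by
      have : {b | G.hdeg b ≤ n} = ⋃ i ∈ Set.Iic n, {b | G.hdeg b = i} := by ext; simp
      rw [this]
      exact (Set.finite_Iic n).biUnion fun i _ => G.finite_fiber i
    refine (h1.prod h2).subset ?_
    rintro ⟨b, b'⟩ h
    simp only [Set.mem_ofPred_eq] at h
    exact ⟨show F.hdeg b ≤ n by omega, show G.hdeg b' ≤ n by omega⟩
  hdeg_col := by
    classical
    rintro ⟨a, a'⟩ ⟨b, b'⟩ h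
    rw [tensorCol_apply] at h
    change F.hdeg a + G.hdeg a' = F.hdeg b + G.hdeg b' + 1
    rcases ne_or_eq (if a' = b' then F.col a b else 0) 0 with h1 | h1
    · split_ifs at h1 with h2
      · have := F.hdeg_col a b h1
        rw [h2]
        omega
      · exact absurd rfl h1
    · rw [h1, zero_add] at h
      have h := right_ne_zero_of_mul h
      split_ifs at h with h2
      · have := G.hdeg_col a' b' h
        rw [h2]
        omega
      · exact absurd rfl h
  homog := by
    classical
    rintro ⟨a, a'⟩ ⟨b, b'⟩ h
    rw [tensorCol_apply] at h ⊢
    by_cases h1 : a' = b'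
    · by_cases h2 : a = b
      · exfalso
        subst h1 h2
        have e1 : F.col a a = 0 := by
          by_contra h; have := F.hdeg_col _ _ h; omega
        have e2 : G.col a' a' = 0 := by
          by_contra h; have := G.hdeg_col _ _ h; omega
        simp [e1, e2] at h
      · simp only [h1, h2, if_true, if_false, mul_zero, add_zero] at h ⊢
        obtain ⟨k, hk, hk'⟩ := F.homog a b h
        exact ⟨k, by omega, hk'⟩
    · by_cases h2 : a = b
      · simp only [h1, h2, if_true, if_false, zero_add] at h ⊢
        obtain ⟨k, hk, hk'⟩ := G.homog a' b' (right_ne_zero_of_mul h)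
        refine ⟨k, by omega, ?_⟩
        have hs : ((-1 : MvPolynomial σ K) ^ F.hdeg b) = C ((-1) ^ F.hdeg b) := by simp
        rw [hs]
        exact hk'.C_mul _
      · simp [h1, h2] at h
  minimal := by
    classical
    rintro ⟨a, a'⟩ ⟨b, b'⟩
    rw [tensorCol_apply, map_add, map_mul]
    split_ifs <;> simp [F.minimal, G.minimal]
  d_col := tensorD_tensorCol F G
  exact z hz hzI := by
    refine tensor_exact F G hTor (z.support.sup (fun p => F.hdeg p.1) + 1) z ?_ hz hzI
    intro b b' h
    have := Finset.le_sup (f := fun p : F.B × G.B => F.hdeg p.1) (Finsupp.mem_support_iff.2 h)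
    exact Nat.lt_succ_of_le this
  col_base_mem p := by
    have := tensorD_base_mem F G (Finsupp.single p 1)
    simpa [tensorD] using this

lemma tensor_degLE {F : QuotientResolution I} {G : QuotientResolution J} {r s : ℕ}
    (hF : F.DegLE r) (hG : G.DegLE s) (hTor : F.TorIndependent J) :
    (F.tensor G hTor).DegLE (r + s) := by
  rintro ⟨b, b'⟩
  have h1 := hF b
  have h2 := hG b'
  change F.deg b + G.deg b' ≤ F.hdeg b + G.hdeg b' + (r + s)
  omega

end QuotientResolution

/-! ### Adding a nonzerodivisor -/

/-- `S ⧸ I` has a minimal graded free resolution whose basis elements in homological degree `i`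
have internal degree at most `i + r`. -/
def HasResolutionLE {σ K : Type*} [Field K] (I : Ideal (MvPolynomial σ K)) (r : ℕ) : Prop :=
  ∃ F : QuotientResolution I, F.DegLE r

lemma hasResolutionLE_bot {σ K : Type*} [Field K] :
    HasResolutionLE (⊥ : Ideal (MvPolynomial σ K)) 0 := by
  refine ⟨{ B := Unit, base := (), hdeg := fun _ => 0, deg := fun _ => 0, col := fun _ => 0,
            hdeg_eq_zero := by simp, deg_base := rfl,
            finite_fiber := fun n => Set.toFinite _,
            hdeg_col := by simp, homog := by simp, minimal := by simp, d_col := by simp,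
            exact := fun z _ hz => ⟨0, (map_zero _).trans
              (Finsupp.ext fun _ => ((Submodule.mem_bot _).1 hz).symm)⟩, col_base_mem := by simp }, fun b => le_rfl⟩

/-- The Koszul complex `S --f--> S` of a nonzero homogeneous polynomial of positive degree. -/
noncomputable def koszulResolution {σ K : Type*} [Field K] (f : MvPolynomial σ K) (k : ℕ)
    (hf : f.IsHomogeneous (k + 1)) (hf0 : f ≠ 0) : QuotientResolution (Ideal.span {f}) where
  B := Bool
  base := false
  hdeg b := cond b 1 0
  deg b := cond b (k + 1) 0
  col b := cond b (Finsupp.single false f) 0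
  hdeg_eq_zero := by simp
  deg_base := rfl
  finite_fiber n := Set.toFinite _
  hdeg_col := by
    rintro (_ | _) (_ | _) h <;> simp_all
  homog := by
    rintro (_ | _) (_ | _) h
    · simp at h
    · simp at h
    · exact ⟨k + 1, rfl, by simpa using hf⟩
    · simp at h
  minimal := by
    have : constantCoeff f = 0 := hf.coeff_eq_zero (d := 0) (by simp)
    rintro (_ | _) (_ | _) <;> simp [this]
  d_col := by
    rintro (_ | _) <;> simp
  exact z hz hzI := by
    obtain ⟨t, ht⟩ := Ideal.mem_span_singleton'.1 hzI
    have h1 : z true = 0 := by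
      rw [Finsupp.linearCombination_apply, Finsupp.sum_fintype _ _ (by simp)] at hz
      have := DFunLike.congr_fun hz false
      simpa [hf0] using this
    refine ⟨Finsupp.single true t, ?_⟩
    ext1 b
    cases b <;> simp [ht, h1]
  col_base_mem := by
    rintro (_ | _) <;> simp

namespace QuotientResolution

variable {σ K : Type*} [Field K] {I : Ideal (MvPolynomial σ K)}

lemma torIndependent_span_singleton (F : QuotientResolution I) {f : MvPolynomial σ K}
    (hf0 : f ≠ 0) (hf : ∀ g, f * g ∈ I → g ∈ I) : F.TorIndependent (Ideal.span {f}) := by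
  intro y hy hyI
  have hex : ∀ s, ∃ t, (s ∈ Ideal.span {f} → f * t = s) ∧ (s = 0 → t = 0) := by
    intro s
    by_cases hs : s = 0
    · exact ⟨0, by simp [hs], fun _ => rfl⟩
    · by_cases h : s ∈ Ideal.span {f}
      · obtain ⟨t, ht⟩ := Ideal.mem_span_singleton.1 h
        exact ⟨t, fun _ => ht.symm, fun h => absurd h hs⟩
      · exact ⟨0, fun h' => absurd h' h, fun _ => rfl⟩
  choose g hg hg0 using hex
  set w := Finsupp.mapRange g (hg0 0 rfl) (F.d y) with hw
  have hfw : f • w = F.d y := by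
    ext1 b
    rw [hw, Finsupp.smul_apply, Finsupp.mapRange_apply, smul_eq_mul]
    exact hg _ (hy b)
  have hdw : F.d w = 0 := by
    have h1 : f • F.d w = 0 := by rw [← map_smul, hfw, d_d]
    ext1 b
    have h2 := DFunLike.congr_fun h1 b
    rw [Finsupp.smul_apply, smul_eq_mul, Finsupp.zero_apply] at h2
    exact (mul_eq_zero.1 h2).resolve_left hf0
  obtain ⟨w', hw'⟩ := F.exact w hdw (hf _ (by
    have := DFunLike.congr_fun hfw F.base
    rw [Finsupp.smul_apply, smul_eq_mul] at this
    rw [this]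
    exact F.d_base_mem y))
  change F.d w' = w at hw'
  obtain ⟨i, hi, j, hj, hij⟩ : ∃ i ∈ I, ∃ j ∈ Ideal.span {f}, i + j = y F.base - f * w' F.base :=
    Submodule.mem_sup.1 (sub_mem hyI (Ideal.mem_sup_right
      (Ideal.mul_mem_right _ _ (Ideal.mem_span_singleton_self f))))
  obtain ⟨u, hu⟩ := F.exact (y - f • w' - Finsupp.single F.base j)
    (by
      change F.d _ = 0
      rw [map_sub, map_sub, map_smul, hw', hfw, d_single, col_base]
      simp)
    (by
      simp only [Finsupp.sub_apply, Finsupp.smul_apply, smul_eq_mul, Finsupp.single_eq_same]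
      rwa [← hij, add_sub_cancel_right])
  change F.d u = _ at hu
  refine ⟨u, fun b => ?_⟩
  classical
  have h1 : y b - F.d u b = f * w' b + Finsupp.single F.base j b := by
    rw [hu]
    simp only [Finsupp.sub_apply, Finsupp.smul_apply, smul_eq_mul]
    ring
  rw [h1]
  refine add_mem (Ideal.mul_mem_right _ _ (Ideal.mem_span_singleton_self f)) ?_
  rw [Finsupp.single_apply]
  split_ifs
  · exact hj
  · exact zero_mem _

end QuotientResolution

lemma HasResolutionLE.sup_span_singleton {σ K : Type*} [Field K] {I : Ideal (MvPolynomial σ K)}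
    {r : ℕ} (h : HasResolutionLE I r) {f : MvPolynomial σ K} {k : ℕ}
    (hf : f.IsHomogeneous (k + 1)) (hf0 : f ≠ 0) (hfI : ∀ g, f * g ∈ I → g ∈ I) :
    HasResolutionLE (I ⊔ Ideal.span {f}) (r + k) := by
  obtain ⟨F, hF⟩ := h
  refine ⟨F.tensor (koszulResolution f k hf hf0) (F.torIndependent_span_singleton hf0 hfI),
    QuotientResolution.tensor_degLE hF ?_ _⟩
  rintro (_ | _)
  · exact Nat.zero_le _
  · exact (Nat.add_comm k 1).le

/-! ### Extending the set of variables -/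

namespace QuotientResolution

variable {σ τ β K : Type*} [Field K] {I : Ideal (MvPolynomial σ K)}

/-- The columns of the differential after extension of the set of variables. -/
noncomputable def renameCol (F : QuotientResolution I) (ι : σ → τ) (b : F.B) :
    F.B →₀ MvPolynomial τ K :=
  Finsupp.mapRange (rename ι) (map_zero _) (F.col b)

lemma renameCol_apply (F : QuotientResolution I) (ι : σ → τ) (b c : F.B) :
    F.renameCol ι b c = rename ι (F.col b c) :=
  Finsupp.mapRange_apply ..

/-- A map that is linear over the polynomials in the old variables, applied to the coordinates,
commutes with the differential. -/
lemma map_linearCombination_renameCol (F : QuotientResolution I) (ι : σ → τ)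
    (μ : MvPolynomial τ K →+ MvPolynomial σ K)
    (hμ : ∀ a s, μ (s * rename ι a) = μ s * a) (y : F.B →₀ MvPolynomial τ K) (c : F.B) :
    μ (Finsupp.linearCombination (MvPolynomial τ K) (F.renameCol ι) y c) =
      F.d (Finsupp.mapRange μ (map_zero μ) y) c := by
  induction y using Finsupp.induction_linear with
  | zero => simp
  | add x y hx hy =>
    rw [map_add, Finsupp.add_apply, map_add, hx, hy, Finsupp.mapRange_add (map_add μ), map_add,
      Finsupp.add_apply]
  | single b s =>
    rw [Finsupp.linearCombination_single, Finsupp.smul_apply, smul_eq_mul, renameCol_apply, hμ,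
      Finsupp.mapRange_single, d_single]
    rfl

lemma map_linearCombination_renameCol' (F : QuotientResolution I) (ι : σ → τ)
    (μ : MvPolynomial τ K →+ MvPolynomial τ K)
    (hμ : ∀ a s, μ (s * rename ι a) = μ s * rename ι a) (y : F.B →₀ MvPolynomial τ K) (c : F.B) :
    μ (Finsupp.linearCombination (MvPolynomial τ K) (F.renameCol ι) y c) =
      Finsupp.linearCombination (MvPolynomial τ K) (F.renameCol ι)
        (Finsupp.mapRange μ (map_zero μ) y) c := by
  induction y using Finsupp.induction_linear with
  | zero => simp
  | add x y hx hy =>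
    rw [map_add, Finsupp.add_apply, map_add, hx, hy, Finsupp.mapRange_add (map_add μ), map_add,
      Finsupp.add_apply]
  | single b s =>
    rw [Finsupp.linearCombination_single, Finsupp.smul_apply, smul_eq_mul, renameCol_apply, hμ,
      Finsupp.mapRange_single, Finsupp.linearCombination_single, Finsupp.smul_apply, smul_eq_mul,
      renameCol_apply]

lemma linearCombination_renameCol_mapRange (F : QuotientResolution I) (ι : σ → τ)
    (z : F.B →₀ MvPolynomial σ K) (c : F.B) :
    Finsupp.linearCombination (MvPolynomial τ K) (F.renameCol ι)
      (Finsupp.mapRange (rename ι) (map_zero _) z) c = rename ι (F.d z c) := by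
  induction z using Finsupp.induction_linear with
  | zero => simp
  | add x y hx hy =>
    rw [Finsupp.mapRange_add (map_add _), map_add, map_add, Finsupp.add_apply, Finsupp.add_apply,
      hx, hy, map_add]
  | single b s =>
    rw [Finsupp.mapRange_single, Finsupp.linearCombination_single, d_single, Finsupp.smul_apply,
      Finsupp.smul_apply, renameCol_apply, smul_eq_mul, smul_eq_mul, map_mul]

/-- The polynomial ring in the variables `β ⊕ σ` as a polynomial ring in `β` over `K[σ]`. -/
noncomputable def splitVariables (e : β ⊕ σ ≃ τ) :
    MvPolynomial τ K ≃ₐ[K] MvPolynomial β (MvPolynomial σ K) :=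
  (renameEquiv K e.symm).trans (sumAlgEquiv K β σ)

lemma splitVariables_rename_inr (e : β ⊕ σ ≃ τ) (a : MvPolynomial σ K) :
    splitVariables e (rename (e ∘ Sum.inr) a) = C a := by
  have h : ((splitVariables (K := K) e).toAlgHom.comp (rename (e ∘ Sum.inr))) =
      IsScalarTower.toAlgHom K (MvPolynomial σ K) (MvPolynomial β (MvPolynomial σ K)) := by
    ext i
    simp [splitVariables]
  exact DFunLike.congr_fun h a

/-- `K[τ]` is free over `K[σ]` on the monomials in the other variables, so exactness may be checked
on coordinates. -/
lemma renameCol_exact (F : QuotientResolution I) (e : β ⊕ σ ≃ τ)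
    (y : F.B →₀ MvPolynomial τ K)
    (hy : Finsupp.linearCombination (MvPolynomial τ K) (F.renameCol (e ∘ Sum.inr)) y = 0)
    (hyI : y F.base ∈ I.map (rename (e ∘ Sum.inr) : MvPolynomial σ K →ₐ[K] MvPolynomial τ K)) :
    ∃ u, Finsupp.linearCombination (MvPolynomial τ K) (F.renameCol (e ∘ Sum.inr)) u = y := by
  classical
  let Θ := splitVariables (K := K) e
  let μ : (β →₀ ℕ) → MvPolynomial τ K →+ MvPolynomial σ K := fun n =>
    (lcoeff (MvPolynomial σ K) n).toAddMonoidHom.comp (Θ : MvPolynomial τ K →+ _)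
  have hμ_apply : ∀ n s, μ n s = coeff n (Θ s) := fun n s => rfl
  have hμ : ∀ n a s, μ n (s * rename (e ∘ Sum.inr) a) = μ n s * a := by
    intro n a s
    rw [hμ_apply, hμ_apply, map_mul, splitVariables_rename_inr, mul_comm _ (C a), coeff_C_mul,
      mul_comm]
  have hI : (I.map (rename (e ∘ Sum.inr) : MvPolynomial σ K →ₐ[K] MvPolynomial τ K)) ≤
      (I.map (C : MvPolynomial σ K →+* MvPolynomial β (MvPolynomial σ K))).comap Θ := by
    rw [Ideal.map_le_iff_le_comap]
    intro a ha
    rw [Ideal.mem_comap, Ideal.mem_comap]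
    change Θ (rename (e ∘ Sum.inr) a) ∈ _
    rw [splitVariables_rename_inr]
    exact Ideal.mem_map_of_mem _ ha
  have hex : ∀ n, ∃ u, F.d u = Finsupp.mapRange (μ n) (map_zero _) y := by
    intro n
    refine F.exact _ ?_ ?_
    · ext1 c
      change F.d _ c = 0
      rw [← F.map_linearCombination_renameCol (e ∘ Sum.inr) (μ n) (hμ n), hy]
      simp
    · rw [Finsupp.mapRange_apply, hμ_apply]
      exact mem_map_C_iff.1 (hI hyI) n
  choose u hu using hex
  -- all monomials in the variables `β` that occur in the coordinates of `y`
  let N : Finset (β →₀ ℕ) := y.support.biUnion fun b => (Θ (y b)).support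
  refine ⟨∑ n ∈ N, Θ.symm (monomial n 1) •
    Finsupp.mapRange (rename (e ∘ Sum.inr)) (map_zero _) (u n), ?_⟩
  ext1 c
  rw [map_sum, Finsupp.finsetSum_apply]
  apply Θ.injective
  rw [map_sum]
  have h1 : ∀ n ∈ N, Θ (Finsupp.linearCombination (MvPolynomial τ K) (F.renameCol (e ∘ Sum.inr))
      (Θ.symm (monomial n 1) • Finsupp.mapRange (rename (e ∘ Sum.inr)) (map_zero _) (u n)) c) =
      monomial n (coeff n (Θ (y c))) := by
    intro n _
    rw [map_smul, Finsupp.smul_apply, linearCombination_renameCol_mapRange, smul_eq_mul, map_mul,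
      AlgEquiv.apply_symm_apply, splitVariables_rename_inr, hu, Finsupp.mapRange_apply, hμ_apply,
      mul_comm, C_mul_monomial, mul_one]
  rw [Finset.sum_congr rfl h1]
  by_cases hc : c ∈ y.support
  · conv_rhs => rw [(Θ (y c)).as_sum]
    refine (Finset.sum_subset (Finset.subset_biUnion_of_mem
      (fun b => (Θ (y b)).support) hc) fun n _ hn => ?_).symm
    rw [notMem_support_iff.1 hn, map_zero]
  · rw [Finsupp.notMem_support_iff.1 hc, map_zero]
    simp

/-- Extension of a resolution to a polynomial ring in more variables. -/
noncomputable def baseChange (F : QuotientResolution I) (e : β ⊕ σ ≃ τ) :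
    QuotientResolution
      (I.map (rename (e ∘ Sum.inr) : MvPolynomial σ K →ₐ[K] MvPolynomial τ K)) where
  B := F.B
  base := F.base
  hdeg := F.hdeg
  deg := F.deg
  col := F.renameCol (e ∘ Sum.inr)
  hdeg_eq_zero := F.hdeg_eq_zero
  deg_base := F.deg_base
  finite_fiber := F.finite_fiber
  hdeg_col b c h := F.hdeg_col b c fun h0 => h (by rw [renameCol_apply, h0, map_zero])
  homog b c h := by
    obtain ⟨k, hk, hk'⟩ := F.homog b c fun h0 => h (by rw [renameCol_apply, h0, map_zero])
    exact ⟨k, hk, by rw [renameCol_apply]; exact hk'.rename_isHomogeneous⟩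
  minimal b c := by
    rw [renameCol_apply, constantCoeff_rename, F.minimal]
  d_col b := by
    ext1 c
    have h : F.d (F.col b) = 0 := F.d_col b
    have := F.linearCombination_renameCol_mapRange (e ∘ Sum.inr) (F.col b) c
    rw [h, Finsupp.zero_apply, map_zero] at this
    exact this
  exact := F.renameCol_exact e
  col_base_mem b := by
    rw [renameCol_apply]
    exact Ideal.mem_map_of_mem _ (F.col_base_mem b)

end QuotientResolution

/-- An ideal extended from `K[β]` has a complement in `K[β ⊕ σ]` as a `K[σ]`-module. The map `π` is
the projection onto such a complement. -/
lemma exists_projection {σ τ β K : Type*} [Field K] (e : β ⊕ σ ≃ τ)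
    (J : Ideal (MvPolynomial β K)) :
    ∃ π : MvPolynomial τ K →+ MvPolynomial τ K,
      (∀ a s, π (s * rename (e ∘ Sum.inr) a) = π s * rename (e ∘ Sum.inr) a) ∧
      (∀ s ∈ J.map (rename (e ∘ Sum.inl) : MvPolynomial β K →ₐ[K] MvPolynomial τ K), π s = 0) ∧
      ∀ s, s - π s ∈ J.map (rename (e ∘ Sum.inl) : MvPolynomial β K →ₐ[K] MvPolynomial τ K) := by
  classical
  obtain ⟨q, hq⟩ := LinearMap.exists_leftInverse_of_injective (J.restrictScalars K).subtype
    (Submodule.ker_subtype _)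
  let p : MvPolynomial β K →ₗ[K] MvPolynomial β K :=
    LinearMap.id - (J.restrictScalars K).subtype ∘ₗ q
  have hp_apply : ∀ x, p x = x - q x := fun x => rfl
  have hp0 : ∀ x ∈ J, p x = 0 := fun x hx => by
    have h1 : q x = ⟨x, hx⟩ := DFunLike.congr_fun hq (⟨x, hx⟩ : J.restrictScalars K)
    rw [hp_apply, h1, sub_self]
  have hpJ : ∀ x, x - p x ∈ J := fun x => by
    rw [hp_apply, sub_sub_cancel]
    exact (q x).2
  let Θ := QuotientResolution.splitVariables (K := K) ((Equiv.sumComm σ β).trans e)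
  have hΘ : ∀ a : MvPolynomial β K, Θ (rename (e ∘ Sum.inl) a) = C a :=
    QuotientResolution.splitVariables_rename_inr (K := K) ((Equiv.sumComm σ β).trans e)
  have hΘX : ∀ i : σ, Θ (X (e (Sum.inr i))) = X i := by
    intro i
    simp [Θ, QuotientResolution.splitVariables]
  -- the `K`-linear projection `p` of `K[β]` with kernel `J`, applied to all coefficients
  let ρ : MvPolynomial σ (MvPolynomial β K) → MvPolynomial σ (MvPolynomial β K) := fun s =>
    ∑ m ∈ s.support, monomial m (p (coeff m s))
  have hρ : ∀ s n, coeff n (ρ s) = p (coeff n s) := by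
    intro s n
    simp only [ρ, coeff_sum, coeff_monomial, Finset.sum_ite_eq', mem_support_iff]
    split_ifs with h
    · rfl
    · rw [not_not.1 h, map_zero]
  have hρ_add : ∀ s t, ρ (s + t) = ρ s + ρ t := by
    intro s t
    ext1 n
    rw [coeff_add, hρ, hρ, hρ, coeff_add, map_add]
  have hρ_C : ∀ (k : K) s, ρ (s * C (C k)) = ρ s * C (C k) := by
    intro k s
    ext1 n
    rw [hρ, mul_comm, coeff_C_mul, mul_comm (ρ s), coeff_C_mul, hρ, C_mul', map_smul, C_mul']
  have hρ_X : ∀ (i : σ) s, ρ (s * X i) = ρ s * X i := by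
    intro i s
    ext1 n
    rw [hρ, coeff_mul_X', coeff_mul_X', hρ]
    split_ifs <;> simp
  have hJ : (J.map (rename (e ∘ Sum.inl) : MvPolynomial β K →ₐ[K] MvPolynomial τ K)) =
      (J.map (C : MvPolynomial β K →+* MvPolynomial σ (MvPolynomial β K))).comap Θ := by
    have h2 : (J.map (C : MvPolynomial β K →+* MvPolynomial σ (MvPolynomial β K))) =
        (J.map (rename (e ∘ Sum.inl) : MvPolynomial β K →ₐ[K] MvPolynomial τ K)).map
          (Θ : MvPolynomial τ K →+* _) := by
      change _ = (Ideal.map ((rename (e ∘ Sum.inl) : MvPolynomial β K →ₐ[K]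
        MvPolynomial τ K) : MvPolynomial β K →+* MvPolynomial τ K) J).map _
      rw [Ideal.map_map]
      congr 1
      exact RingHom.ext fun a => (hΘ a).symm
    rw [h2]
    exact (Ideal.comap_map_of_bijective _ Θ.bijective).symm
  refine ⟨⟨⟨fun s => Θ.symm (ρ (Θ s)), ?_⟩, ?_⟩, ?_, ?_, ?_⟩
  · have : ρ 0 = 0 := by ext1 n; rw [hρ, coeff_zero, map_zero]
    simp [this]
  · intro s t
    simp [hρ_add]
  · intro a s
    change Θ.symm (ρ (Θ (s * _))) = Θ.symm (ρ (Θ s)) * _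
    apply Θ.injective
    rw [Θ.apply_symm_apply, map_mul, map_mul, Θ.apply_symm_apply]
    generalize Θ s = t
    induction a using MvPolynomial.induction_on generalizing t with
    | C k =>
      have : Θ (rename (e ∘ Sum.inr) (C k)) = C (C k) := by
        rw [rename_C, ← hΘ, rename_C]
      rw [this, hρ_C]
    | add a b ha hb => rw [map_add, map_add, mul_add, hρ_add, ha, hb, mul_add]
    | mul_X a i ha =>
      rw [map_mul, map_mul, rename_X, Function.comp_apply, hΘX, ← mul_assoc, hρ_X, ha, mul_assoc]
  · intro s hs
    change Θ.symm (ρ (Θ s)) = 0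
    rw [hJ, Ideal.mem_comap] at hs
    have : ρ (Θ s) = 0 := by
      ext1 n
      rw [hρ, hp0 _ (mem_map_C_iff.1 hs n), coeff_zero]
    rw [this, map_zero]
  · intro s
    rw [hJ, Ideal.mem_comap]
    change Θ (s - Θ.symm (ρ (Θ s))) ∈ _
    rw [map_sub, Θ.apply_symm_apply]
    refine mem_map_C_iff.2 fun n => ?_
    rw [coeff_sub, hρ]
    exact hpJ _

namespace QuotientResolution

variable {σ τ β K : Type*} [Field K] {I : Ideal (MvPolynomial σ K)}

lemma torIndependent_baseChange (F : QuotientResolution I) (e : β ⊕ σ ≃ τ)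
    (J : Ideal (MvPolynomial β K)) : (F.baseChange e).TorIndependent
      (J.map (rename (e ∘ Sum.inl) : MvPolynomial β K →ₐ[K] MvPolynomial τ K)) := by
  intro y hy hyI
  obtain ⟨π, hπ, hπ0, hπJ⟩ := exists_projection e J
  obtain ⟨u, hu⟩ := (F.baseChange e).exact (Finsupp.mapRange π (map_zero π) y)
    (by
      ext1 c
      have := F.map_linearCombination_renameCol' (e ∘ Sum.inr) π hπ y c
      exact this.symm.trans (hπ0 _ (hy c)))
    (by
      rw [Finsupp.mapRange_apply]
      obtain ⟨i, hi, j, hj, hij⟩ := Submodule.mem_sup.1 hyI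
      rw [← hij, map_add, hπ0 j hj, add_zero]
      have key : ∀ s, π (s * i) ∈ I.map
          (rename (e ∘ Sum.inr) : MvPolynomial σ K →ₐ[K] MvPolynomial τ K) := by
        refine Submodule.span_induction (p := fun i _ => ∀ s, π (s * i) ∈ I.map
          (rename (e ∘ Sum.inr) : MvPolynomial σ K →ₐ[K] MvPolynomial τ K)) ?_ ?_ ?_ ?_ hi
        · rintro _ ⟨a, ha, rfl⟩ s
          change π (s * rename (e ∘ Sum.inr) a) ∈ _
          rw [hπ]
          exact Ideal.mul_mem_left _ _ (Ideal.mem_map_of_mem _ ha)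
        · intro s
          rw [mul_zero, map_zero]
          exact zero_mem _
        · intro x y _ _ hx hy s
          rw [mul_add, map_add]
          exact add_mem (hx s) (hy s)
        · intro t x _ hx s
          rw [smul_eq_mul, ← mul_assoc]
          exact hx _
      simpa using key 1)
  refine ⟨u, fun b => ?_⟩
  have h1 : (F.baseChange e).d u b = π (y b) := by
    have := DFunLike.congr_fun hu b
    rwa [Finsupp.mapRange_apply] at this
  rw [h1]
  exact hπJ _

end QuotientResolution

/-- Regularity bounds add up for ideals in disjoint sets of variables. -/
lemma HasResolutionLE.map_sup_map {σ τ β K : Type*} [Field K] {I : Ideal (MvPolynomial σ K)}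
    {J : Ideal (MvPolynomial β K)} {r s : ℕ} (e : β ⊕ σ ≃ τ) (hI : HasResolutionLE I r)
    (hJ : HasResolutionLE
      (J.map (rename (e ∘ Sum.inl) : MvPolynomial β K →ₐ[K] MvPolynomial τ K)) s) :
    HasResolutionLE
      (I.map (rename (e ∘ Sum.inr) : MvPolynomial σ K →ₐ[K] MvPolynomial τ K) ⊔
        J.map (rename (e ∘ Sum.inl) : MvPolynomial β K →ₐ[K] MvPolynomial τ K)) (r + s) := by
  obtain ⟨F, hF⟩ := hI
  obtain ⟨G, hG⟩ := hJ
  exact ⟨(F.baseChange e).tensor G (F.torIndependent_baseChange e J),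
    QuotientResolution.tensor_degLE (F := F.baseChange e) hF hG _⟩

/-! ### Resolutions of ideals and of quotient rings -/

namespace MinimalGradedFreeResolution

variable {σ K : Type*} [Field K] {I : Ideal (MvPolynomial σ K)}

lemma aug_mem (F : MinimalGradedFreeResolution I) (v : Fin (F.rank 0) → MvPolynomial σ K) :
    F.aug v ∈ I :=
  F.range_aug.le (LinearMap.mem_range_self _ _)

/-- The columns of the resolution of `S ⧸ I` attached to a resolution of `I`: the basis element
`none` spans homological degree `0`, everything else is shifted by one. -/
noncomputable def quotientCol (F : MinimalGradedFreeResolution I) :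
    Option (Σ i, Fin (F.rank i)) → (Option (Σ i, Fin (F.rank i)) →₀ MvPolynomial σ K)
  | none => 0
  | some ⟨0, b⟩ => Finsupp.single none (F.aug (Pi.single b 1))
  | some ⟨i + 1, b⟩ => ∑ a, Finsupp.single (some ⟨i, a⟩) (F.d i (Pi.single b 1) a)

/-- The homological degree in the resolution of `S ⧸ I`. -/
def quotientHdeg (F : MinimalGradedFreeResolution I) : Option (Σ i, Fin (F.rank i)) → ℕ
  | none => 0
  | some ⟨i, _⟩ => i + 1

/-- The internal degree in the resolution of `S ⧸ I`. -/
def quotientDeg (F : MinimalGradedFreeResolution I) : Option (Σ i, Fin (F.rank i)) → ℕ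
  | none => 0
  | some ⟨i, b⟩ => F.deg i b

/-- The component in homological degree `i`. -/
noncomputable def component (F : MinimalGradedFreeResolution I) (i : ℕ)
    (z : Option (Σ i, Fin (F.rank i)) →₀ MvPolynomial σ K) : Fin (F.rank i) → MvPolynomial σ K :=
  fun a => z (some ⟨i, a⟩)

lemma component_add (F : MinimalGradedFreeResolution I) (i : ℕ)
    (y z : Option (Σ i, Fin (F.rank i)) →₀ MvPolynomial σ K) :
    F.component i (y + z) = F.component i y + F.component i z := rfl

lemma component_single_same (F : MinimalGradedFreeResolution I) (i : ℕ) (b : Fin (F.rank i))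
    (s : MvPolynomial σ K) :
    F.component i (Finsupp.single (some ⟨i, b⟩) s) = s • Pi.single b 1 := by
  classical
  ext1 a
  rw [component, Finsupp.single_apply, Pi.smul_apply, Pi.single_apply]
  by_cases h : a = b
  · subst h; simp
  · have : (some ⟨i, b⟩ : Option (Σ i, Fin (F.rank i))) ≠ some ⟨i, a⟩ := by
      intro h'
      simp only [Option.some.injEq, Sigma.mk.injEq, heq_eq_eq, true_and] at h'
      exact h h'.symm
    rw [if_neg this, if_neg h, smul_zero]

lemma component_single_of_ne (F : MinimalGradedFreeResolution I) {i j : ℕ} (h : j ≠ i)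
    (b : Fin (F.rank j)) (s : MvPolynomial σ K) :
    F.component i (Finsupp.single (some ⟨j, b⟩) s) = 0 := by
  ext1 a
  refine Finsupp.single_eq_of_ne ?_
  intro h'
  simp only [Option.some.injEq, Sigma.mk.injEq] at h'
  exact h h'.1.symm

lemma component_single_none (F : MinimalGradedFreeResolution I) (i : ℕ)
    (s : MvPolynomial σ K) :
    F.component i (Finsupp.single none s) = 0 := by
  ext1 a
  exact Finsupp.single_eq_of_ne (by simp)

lemma component_quotientCol (F : MinimalGradedFreeResolution I) (i : ℕ)
    (b : Fin (F.rank (i + 1))) :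
    F.component i (F.quotientCol (some ⟨i + 1, b⟩)) = F.d i (Pi.single b 1) := by
  classical
  ext1 a
  rw [component, quotientCol, Finsupp.finsetSum_apply, Finset.sum_eq_single a]
  · simp
  · intro c _ hc
    refine Finsupp.single_eq_of_ne ?_
    intro h'
    simp only [Option.some.injEq, Sigma.mk.injEq, heq_eq_eq, true_and] at h'
    exact hc h'.symm
  · simp

lemma component_quotientCol_of_ne (F : MinimalGradedFreeResolution I) {i j : ℕ} (h : j ≠ i + 1)
    (b : Fin (F.rank j)) : F.component i (F.quotientCol (some ⟨j, b⟩)) = 0 := by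
  ext1 a
  cases j with
  | zero => exact Finsupp.single_eq_of_ne (by simp)
  | succ j =>
    rw [component, quotientCol, Finsupp.finsetSum_apply]
    refine Finset.sum_eq_zero fun c _ => Finsupp.single_eq_of_ne ?_
    intro h'
    simp only [Option.some.injEq, Sigma.mk.injEq] at h'
    omega

lemma quotientCol_none_apply (F : MinimalGradedFreeResolution I)
    (i : ℕ) (b : Fin (F.rank (i + 1))) : F.quotientCol (some ⟨i + 1, b⟩) none = 0 := by
  rw [quotientCol, Finsupp.finsetSum_apply]
  exact Finset.sum_eq_zero fun c _ => Finsupp.single_eq_of_ne (by simp)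

lemma component_quotientD (F : MinimalGradedFreeResolution I) (i : ℕ)
    (z : Option (Σ i, Fin (F.rank i)) →₀ MvPolynomial σ K) :
    F.component i (Finsupp.linearCombination (MvPolynomial σ K) F.quotientCol z) =
      F.d i (F.component (i + 1) z) := by
  induction z using Finsupp.induction_linear with
  | zero =>
    rw [map_zero]
    exact (map_zero (F.d i)).symm
  | add x y hx hy => rw [map_add, component_add, component_add, map_add, hx, hy]
  | single b s =>
    rw [Finsupp.linearCombination_single]
    have hs : ∀ z, F.component i (s • z) = s • F.component i z := fun z => rfl
    rw [hs]
    rcases b with _ | ⟨j, b⟩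
    · rw [component_single_none, map_zero]
      exact smul_zero s
    · by_cases h : j = i + 1
      · subst h
        rw [component_quotientCol, component_single_same, map_smul]
      · rw [component_quotientCol_of_ne F h, component_single_of_ne F h, map_zero, smul_zero]

lemma quotientD_none (F : MinimalGradedFreeResolution I)
    (z : Option (Σ i, Fin (F.rank i)) →₀ MvPolynomial σ K) :
    Finsupp.linearCombination (MvPolynomial σ K) F.quotientCol z none =
      F.aug (F.component 0 z) := by
  induction z using Finsupp.induction_linear with
  | zero =>
    rw [map_zero]
    exact (map_zero F.aug).symm
  | add x y hx hy => rw [map_add, component_add, map_add, Finsupp.add_apply, hx, hy]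
  | single b s =>
    rw [Finsupp.linearCombination_single, Finsupp.smul_apply]
    rcases b with _ | ⟨j, b⟩
    · rw [component_single_none, map_zero]
      exact smul_zero s
    · rcases j with _ | j
      · rw [component_single_same, map_smul]
        simp [quotientCol]
      · rw [quotientCol_none_apply, component_single_of_ne F (by omega), map_zero, smul_zero]

lemma ext_component (F : MinimalGradedFreeResolution I)
    {y z : Option (Σ i, Fin (F.rank i)) →₀ MvPolynomial σ K} (h : y none = z none)
    (h' : ∀ i, F.component i y = F.component i z) : y = z := by
  ext1 b
  rcases b with _ | ⟨i, b⟩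
  · exact h
  · exact congrFun (h' i) b

/-- The minimal resolution of `S ⧸ I` attached to a minimal resolution of a proper ideal `I`. -/
noncomputable def toQuotient (F : MinimalGradedFreeResolution I)
    (hI : ∀ f ∈ I, constantCoeff f = 0) : QuotientResolution I where
  B := Option (Σ i, Fin (F.rank i))
  base := none
  hdeg := F.quotientHdeg
  deg := F.quotientDeg
  col := F.quotientCol
  hdeg_eq_zero := by
    rintro (_ | ⟨i, b⟩) <;> simp [quotientHdeg]
  deg_base := rfl
  finite_fiber n := by
    rcases n with _ | n
    · refine (Set.finite_singleton none).subset ?_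
      rintro (_ | ⟨i, b⟩) h
      · rfl
      · simp [quotientHdeg] at h
    · refine (Set.finite_range fun b : Fin (F.rank n) => some (Sigma.mk n b)).subset ?_
      rintro (_ | ⟨i, b⟩) h
      · simp [quotientHdeg] at h
      · obtain rfl : i = n := by simpa [quotientHdeg] using h
        exact ⟨b, rfl⟩
  hdeg_col := by
    rintro (_ | ⟨j, b⟩) (_ | ⟨i, c⟩) h
    · exact absurd rfl h
    · exact absurd rfl h
    · rcases j with _ | j
      · rfl
      · exact absurd (F.quotientCol_none_apply j b) h
    · by_contra hne
      exact h (congrFun (F.component_quotientCol_of_ne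
        (fun h' => hne (congrArg (· + 1) h')) b) c)
  homog := by
    rintro (_ | ⟨j, b⟩) (_ | ⟨i, c⟩) h
    · exact absurd rfl h
    · exact absurd rfl h
    · rcases j with _ | j
      · refine ⟨F.deg 0 b, rfl, ?_⟩
        rw [show F.quotientCol (some ⟨0, b⟩) none = F.aug (Pi.single b 1) by simp [quotientCol]]
        exact F.aug_homogeneous b
      · exact absurd (F.quotientCol_none_apply j b) h
    · by_cases hj : j = i + 1
      · subst hj
        have h1 := congrFun (F.component_quotientCol i b) c
        change F.quotientCol _ _ = _ at h1
        rw [h1] at h ⊢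
        exact F.d_homogeneous i b c h
      · exact absurd (congrFun (F.component_quotientCol_of_ne hj b) c) h
  minimal := by
    rintro (_ | ⟨j, b⟩) (_ | ⟨i, c⟩)
    · exact map_zero _
    · exact map_zero _
    · rcases j with _ | j
      · rw [show F.quotientCol (some ⟨0, b⟩) none = F.aug (Pi.single b 1) by simp [quotientCol]]
        exact hI _ (F.aug_mem _)
      · rw [quotientCol_none_apply, map_zero]
    · by_cases hj : j = i + 1
      · subst hj
        have h1 := congrFun (F.component_quotientCol i b) c
        change F.quotientCol _ _ = _ at h1
        rw [h1]
        exact F.minimal _ _ _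
      · have h1 := congrFun (F.component_quotientCol_of_ne hj b) c
        change F.quotientCol _ _ = _ at h1
        rw [h1]
        exact map_zero _
  d_col := by
    have hzero : ∀ i, F.component i 0 = 0 := fun i => rfl
    rintro (_ | ⟨j, b⟩)
    · exact map_zero _
    · refine F.ext_component ?_ fun i => ?_
      · rw [quotientD_none]
        rcases Decidable.em (j = 1) with rfl | hj
        · rw [component_quotientCol]
          have : F.d 0 (Pi.single b 1) ∈ LinearMap.ker F.aug := by
            rw [← F.exact_zero]
            exact LinearMap.mem_range_self _ _
          exact this
        · rw [component_quotientCol_of_ne F (by omega), map_zero]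
          rfl
      · rw [component_quotientD, hzero]
        rcases Decidable.em (j = i + 1 + 1) with rfl | hj
        · rw [component_quotientCol]
          have : F.d (i + 1) (Pi.single b 1) ∈ LinearMap.ker (F.d i) := by
            rw [← F.exact_succ]
            exact LinearMap.mem_range_self _ _
          exact this
        · rw [component_quotientCol_of_ne F hj, map_zero]
  exact z hz hzI := by
    classical
    have hzero : ∀ i, F.component i 0 = 0 := fun i => rfl
    have h0 : ∃ u, F.aug u = z none := F.range_aug.ge hzI
    have h1 : ∀ i, ∃ u, F.d i u = F.component i z := by
      intro i
      rcases i with _ | i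
      · have : F.component 0 z ∈ LinearMap.ker F.aug := by
          rw [LinearMap.mem_ker, ← quotientD_none, hz]
          rfl
        rw [← F.exact_zero] at this
        exact this
      · have : F.component (i + 1) z ∈ LinearMap.ker (F.d i) := by
          rw [LinearMap.mem_ker, ← component_quotientD, hz, hzero]
        rw [← F.exact_succ] at this
        exact this
    obtain ⟨u₀, hu₀⟩ := h0
    choose u hu using h1
    let v : ∀ i, Fin (F.rank i) → MvPolynomial σ K := fun i =>
      match i with
      | 0 => u₀
      | i + 1 => u i
    let N := z.support.sup F.quotientHdeg
    have hN : ∀ i, N ≤ i → F.component i z = 0 := by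
      intro i hi
      ext1 a
      by_contra hne
      have : F.quotientHdeg (some ⟨i, a⟩) ≤ N :=
        Finset.le_sup (f := F.quotientHdeg) (Finsupp.mem_support_iff.2 hne)
      change i + 1 ≤ N at this
      omega
    let w : Option (Σ i, Fin (F.rank i)) →₀ MvPolynomial σ K :=
      Finsupp.onFinset (((Finset.range (N + 1)).sigma fun _ => Finset.univ).image some)
        (fun x => match x with
          | none => 0
          | some ⟨i, a⟩ => if i < N + 1 then v i a else 0) (by
        rintro (_ | ⟨i, a⟩) h
        · exact absurd rfl h
        · refine Finset.mem_image_of_mem _ (Finset.mem_sigma.2 ⟨?_, Finset.mem_univ _⟩)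
          by_contra hi
          exact h (if_neg fun h' => hi (Finset.mem_range.2 h')))
    have hw : ∀ i, F.component i w = if i < N + 1 then v i else 0 := by
      intro i
      ext1 a
      change (if i < N + 1 then v i a else 0) = _
      split_ifs <;> rfl
    refine ⟨w, F.ext_component ?_ fun i => ?_⟩
    · rw [quotientD_none, hw, if_pos (Nat.succ_pos N)]
      exact hu₀
    · rw [component_quotientD, hw]
      split_ifs with h
      · exact hu i
      · rw [map_zero, hN i (by omega)]
  col_base_mem := by
    rintro (_ | ⟨_ | j, b⟩)
    · exact zero_mem _
    · rw [show F.quotientCol (some ⟨0, b⟩) none = F.aug (Pi.single b 1) by simp [quotientCol]]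
      exact F.aug_mem _
    · rw [quotientCol_none_apply]
      exact zero_mem _

end MinimalGradedFreeResolution

namespace QuotientResolution

variable {σ K : Type*} [Field K] {I : Ideal (MvPolynomial σ K)}

/-- An enumeration of the basis elements of homological degree `i + 1`. -/
noncomputable def enum (F : QuotientResolution I) (i : ℕ) :
    Fin (Nat.card {b // F.hdeg b = i + 1}) ≃ {b // F.hdeg b = i + 1} :=
  haveI : Finite {b // F.hdeg b = i + 1} := F.finite_fiber (i + 1)
  (Finite.equivFin _).symm

/-- The inclusion of the part of homological degree `i + 1`. -/
noncomputable def incl (F : QuotientResolution I) (i : ℕ) :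
    (Fin (Nat.card {b // F.hdeg b = i + 1}) → MvPolynomial σ K) →ₗ[MvPolynomial σ K]
      (F.B →₀ MvPolynomial σ K) :=
  Fintype.linearCombination (MvPolynomial σ K) fun a => Finsupp.single (F.enum i a : F.B) 1

/-- The coordinates of the part of homological degree `i + 1`. -/
noncomputable def coords (F : QuotientResolution I) (i : ℕ) :
    (F.B →₀ MvPolynomial σ K) →ₗ[MvPolynomial σ K]
      (Fin (Nat.card {b // F.hdeg b = i + 1}) → MvPolynomial σ K) :=
  LinearMap.pi fun a => Finsupp.lapply (F.enum i a : F.B)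

lemma coords_apply (F : QuotientResolution I) (i : ℕ) (z : F.B →₀ MvPolynomial σ K)
    (a : Fin (Nat.card {b // F.hdeg b = i + 1})) : F.coords i z a = z (F.enum i a) := rfl

lemma incl_single (F : QuotientResolution I) (i : ℕ)
    (a : Fin (Nat.card {b // F.hdeg b = i + 1})) :
    F.incl i (Pi.single a 1) = Finsupp.single (F.enum i a : F.B) 1 := by
  classical
  rw [incl, Fintype.linearCombination_apply_single, one_smul]

lemma incl_apply_of_ne (F : QuotientResolution I) (i : ℕ)
    (v : Fin (Nat.card {b // F.hdeg b = i + 1}) → MvPolynomial σ K) (b : F.B)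
    (hb : F.hdeg b ≠ i + 1) : F.incl i v b = 0 := by
  rw [incl, Fintype.linearCombination_apply, Finsupp.finsetSum_apply]
  refine Finset.sum_eq_zero fun a _ => ?_
  rw [Finsupp.smul_apply, Finsupp.single_eq_of_ne, smul_zero]
  rintro rfl
  exact hb (F.enum i a).2

lemma coords_incl (F : QuotientResolution I) (i : ℕ)
    (v : Fin (Nat.card {b // F.hdeg b = i + 1}) → MvPolynomial σ K) :
    F.coords i (F.incl i v) = v := by
  classical
  ext1 a
  rw [coords_apply, incl, Fintype.linearCombination_apply, Finsupp.finsetSum_apply,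
    Finset.sum_eq_single a]
  · simp
  · intro c _ hc
    rw [Finsupp.smul_apply, Finsupp.single_eq_of_ne, smul_zero]
    exact fun h => hc ((F.enum i).injective (Subtype.ext h)).symm
  · simp

lemma incl_coords (F : QuotientResolution I) (i : ℕ) (z : F.B →₀ MvPolynomial σ K) :
    F.incl i (F.coords i z) = F.part (i + 1) z := by
  ext1 b
  rw [part_apply]
  split_ifs with h
  · obtain ⟨a, ha⟩ := (F.enum i).surjective ⟨b, h⟩
    have h1 := congrFun (F.coords_incl i (F.coords i z)) a
    rw [coords_apply, coords_apply, ha] at h1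
    exact h1
  · exact F.incl_apply_of_ne i _ b h

lemma incl_coords_d_incl (F : QuotientResolution I) (i : ℕ)
    (v : Fin (Nat.card {b // F.hdeg b = i + 1 + 1}) → MvPolynomial σ K) :
    F.incl i (F.coords i (F.d (F.incl (i + 1) v))) = F.d (F.incl (i + 1) v) := by
  rw [incl_coords]
  ext1 b
  rw [part_apply]
  split_ifs with h
  · rfl
  · exact (F.d_apply_eq_zero _ _ fun c hc => F.incl_apply_of_ne _ _ _ (by omega)).symm

lemma coords_d_incl_coords (F : QuotientResolution I) (i : ℕ) (u : F.B →₀ MvPolynomial σ K) :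
    F.coords i (F.d (F.incl (i + 1) (F.coords (i + 1) u))) = F.coords i (F.d u) := by
  ext1 a
  rw [incl_coords, coords_apply, d_apply_part, if_pos (F.enum i a).2, coords_apply]

/-- The minimal resolution of `I` obtained from one of `S ⧸ I` by deleting homological
degree `0`. -/
noncomputable def toIdeal (F : QuotientResolution I) : MinimalGradedFreeResolution I where
  rank i := Nat.card {b // F.hdeg b = i + 1}
  deg i a := F.deg (F.enum i a)
  aug := Finsupp.lapply F.base ∘ₗ F.d ∘ₗ F.incl 0
  d i := F.coords i ∘ₗ F.d ∘ₗ F.incl (i + 1)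
  aug_homogeneous a := by
    rw [LinearMap.comp_apply, LinearMap.comp_apply, incl_single, d_single, one_smul,
      Finsupp.lapply_apply]
    by_cases h : F.col (F.enum 0 a) F.base = 0
    · rw [h]
      exact isHomogeneous_zero _ _ _
    · obtain ⟨k, hk, hk'⟩ := F.homog _ _ h
      rwa [← hk, F.deg_base]
  d_homogeneous i b a h := by
    rw [LinearMap.comp_apply, LinearMap.comp_apply, incl_single, d_single, one_smul,
      coords_apply] at h ⊢
    exact F.homog _ _ h
  range_aug := by
    refine le_antisymm ?_ fun s hs => ?_
    · rintro _ ⟨v, rfl⟩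
      exact F.d_base_mem _
    · obtain ⟨u, hu⟩ := F.exact (Finsupp.single F.base s)
        (by
          change F.d _ = 0
          rw [d_single, col_base, smul_zero])
        (by simpa using hs)
      refine ⟨F.coords 0 u, ?_⟩
      rw [LinearMap.comp_apply, LinearMap.comp_apply, incl_coords, Finsupp.lapply_apply,
        d_apply_part, if_pos F.hdeg_base]
      change F.d u = _ at hu
      rw [hu, Finsupp.single_eq_same]
  exact_zero := by
    refine le_antisymm ?_ fun v hv => ?_
    · rintro _ ⟨v, rfl⟩
      rw [LinearMap.mem_ker, LinearMap.comp_apply, LinearMap.comp_apply, LinearMap.comp_apply,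
        LinearMap.comp_apply, incl_coords_d_incl, d_d, map_zero]
    · obtain ⟨u, hu⟩ := F.exact (F.incl 0 v)
        (by
          change F.d _ = 0
          ext1 c
          by_cases hc : F.hdeg c = 0
          · rw [(F.hdeg_eq_zero c).1 hc]
            exact hv
          · exact F.d_apply_eq_zero _ _ fun b hb => F.incl_apply_of_ne _ _ _ (by omega))
        (by
          rw [incl_apply_of_ne _ _ _ _ (by rw [hdeg_base]; omega)]
          exact zero_mem _)
      refine ⟨F.coords 1 u, ?_⟩
      change F.d u = _ at hu
      rw [LinearMap.comp_apply, LinearMap.comp_apply, coords_d_incl_coords, hu, coords_incl]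
  exact_succ i := by
    refine le_antisymm ?_ fun v hv => ?_
    · rintro _ ⟨v, rfl⟩
      rw [LinearMap.mem_ker, LinearMap.comp_apply, LinearMap.comp_apply, LinearMap.comp_apply,
        LinearMap.comp_apply, incl_coords_d_incl, d_d, map_zero]
    · obtain ⟨u, hu⟩ := F.exact (F.incl (i + 1) v)
        (by
          change F.d _ = 0
          rw [← incl_coords_d_incl]
          have : F.coords i (F.d (F.incl (i + 1) v)) = 0 := hv
          rw [this, map_zero])
        (by
          rw [incl_apply_of_ne _ _ _ _ (by rw [hdeg_base]; omega)]
          exact zero_mem _)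
      refine ⟨F.coords (i + 1 + 1) u, ?_⟩
      change F.d u = _ at hu
      rw [LinearMap.comp_apply, LinearMap.comp_apply, coords_d_incl_coords, hu, coords_incl]
  minimal i v a := by
    rw [LinearMap.comp_apply, LinearMap.comp_apply, coords_apply, d_apply, Finsupp.sum, map_sum]
    exact Finset.sum_eq_zero fun c _ => by rw [map_mul, F.minimal, mul_zero]

end QuotientResolution

/-! ### Regularity -/

section Regularity

variable {σ K : Type*} [Field K] {I : Ideal (MvPolynomial σ K)}

lemma HasResolutionLE.regularity_le {r : ℕ} (h : HasResolutionLE I r) :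
    regularity I ≤ ((r + 1 : ℕ) : EReal) := by
  obtain ⟨F, hF⟩ := h
  refine sSup_le ?_
  rintro _ ⟨i, j, hij, rfl⟩
  have h1 : F.toIdeal.betti i j ≠ 0 := by
    intro h0
    refine hij (le_antisymm ?_ bot_le)
    have := iInf_le (fun F : MinimalGradedFreeResolution I => (F.betti i j : ℕ∞)) F.toIdeal
    rw [h0] at this
    exact this
  obtain ⟨⟨a, ha⟩⟩ := (Nat.card_ne_zero.1 h1).1
  have h2 := hF (F.enum i a)
  rw [(F.enum i a).2] at h2
  change F.deg (F.enum i a) = j at ha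
  rw [ha] at h2
  rw [← EReal.coe_natCast, EReal.coe_le_coe_iff]
  have : (j : ℝ) ≤ ((i + 1 + r : ℕ) : ℝ) := by exact_mod_cast h2
  push_cast at this ⊢
  linarith

lemma exists_betti_eq_zero {i j : ℕ} (h : gradedBetti I i j = 0) :
    ∃ F : MinimalGradedFreeResolution I, F.betti i j = 0 := by
  by_contra! hne
  have : (1 : ℕ∞) ≤ gradedBetti I i j :=
    le_iInf fun F => by exact_mod_cast Nat.one_le_iff_ne_zero.2 (hne F)
  rw [h] at this
  simp at this

lemma gradedBetti_eq_zero {r i j : ℕ} (h : regularity I ≤ ((r + 1 : ℕ) : EReal))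
    (hij : i + r + 1 < j) : gradedBetti I i j = 0 := by
  by_contra hne
  have h1 := sSup_le_iff.1 h _ ⟨i, j, hne, rfl⟩
  rw [← EReal.coe_natCast, EReal.coe_le_coe_iff] at h1
  have : ((i + r + 1 : ℕ) : ℝ) < j := by exact_mod_cast hij
  push_cast at this h1
  linarith

/-- A bound on the regularity provides one minimal resolution with bounded degrees: the graded
Betti numbers that vanish for some minimal resolution vanish for all of them. -/
lemma hasResolutionLE_of_regularity_le {r : ℕ} (hI : ∀ f ∈ I, constantCoeff f = 0)
    (h : regularity I ≤ ((r + 1 : ℕ) : EReal)) : HasResolutionLE I r := by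
  obtain ⟨F, -⟩ := exists_betti_eq_zero
    (gradedBetti_eq_zero h (i := 0) (j := r + 2) (by omega))
  refine ⟨F.toQuotient hI, ?_⟩
  rintro (_ | ⟨i, b⟩)
  · exact Nat.zero_le _
  · change F.deg i b ≤ i + 1 + r
    by_contra hlt
    obtain ⟨F', hF'⟩ := exists_betti_eq_zero
      (gradedBetti_eq_zero h (i := i) (j := F.deg i b) (by omega))
    obtain ⟨c, hc, hc'⟩ := QuotientResolution.exists_same_degrees (F.toQuotient hI)
      (F'.toQuotient hI) (some ⟨i, b⟩)
    rcases c with _ | ⟨k, c⟩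
    · change 0 = i + 1 at hc
      omega
    · change k + 1 = i + 1 at hc
      obtain rfl : k = i := by omega
      change F'.deg k c = F.deg k b at hc'
      rcases Nat.card_eq_zero.1 hF' with h0 | h0
      · exact h0.elim ⟨c, hc'⟩
      · exact h0.false

end Regularity

/-! ### The multigrading of a binomial edge ideal -/

section Multigrading

variable {V Q K : Type*} [Field K]

/-- The binomial `x_i y_j - x_j y_i`. -/
noncomputable def edgeBinomial (K : Type*) [Field K] (i j : V) : MvPolynomial (V ⊕ V) K :=
  X (Sum.inl i) * X (Sum.inr j) - X (Sum.inl j) * X (Sum.inr i)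

lemma edgeBinomial_mem {H : SimpleGraph V} {i j : V} (h : H.Adj i j) :
    edgeBinomial K i j ∈ binomialEdgeIdeal K H :=
  Ideal.subset_span ⟨i, j, h, rfl⟩

lemma edgeBinomial_self (i : V) : edgeBinomial K i i = 0 := sub_self _

/-- The weights of the `ℤ^V`-grading: both `x_v` and `y_v` have degree `e_v`. -/
noncomputable def vertexWeight (i : V ⊕ V) : V →₀ ℕ := Finsupp.single (Sum.elim id id i) 1

/-- The multidegree of a monomial. -/
noncomputable abbrev mdeg : ((V ⊕ V) →₀ ℕ) →+ (V →₀ ℕ) := Finsupp.weight vertexWeight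

lemma mdeg_apply (m : (V ⊕ V) →₀ ℕ) (v : V) : mdeg m v = m (Sum.inl v) + m (Sum.inr v) := by
  classical
  induction m using Finsupp.induction_linear with
  | zero => simp
  | add x y hx hy => simp only [map_add, Finsupp.add_apply, hx, hy]; omega
  | single b s =>
    rw [Finsupp.weight_single]
    rcases b with b | b <;> by_cases h : b = v <;> simp [vertexWeight, h]

lemma mdeg_single (i : V ⊕ V) : mdeg (Finsupp.single i 1) = vertexWeight i := by
  rw [Finsupp.weight_single, one_smul]

lemma edgeBinomial_isWeightedHomogeneous (i j : V) :
    IsWeightedHomogeneous vertexWeight (edgeBinomial K i j)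
      (Finsupp.single i 1 + Finsupp.single j 1) := by
  refine IsWeightedHomogeneous.sub ?_ ?_
  · exact (isWeightedHomogeneous_X K vertexWeight (Sum.inl i)).mul
      (isWeightedHomogeneous_X K vertexWeight (Sum.inr j))
  · rw [add_comm]
    exact (isWeightedHomogeneous_X K vertexWeight (Sum.inl j)).mul
      (isWeightedHomogeneous_X K vertexWeight (Sum.inr i))

/-- The graph of the edges of `H` with both ends in `W`. -/
def supportGraph (H : SimpleGraph V) (W : Set V) : SimpleGraph V where
  Adj a b := H.Adj a b ∧ a ∈ W ∧ b ∈ W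
  symm := ⟨fun _ _ h => ⟨h.1.symm, h.2.2, h.2.1⟩⟩
  loopless := ⟨fun _ h => h.1.ne rfl⟩

lemma exists_eq_add_single {α : Type*} {m : α →₀ ℕ} {i : α} (h : m i ≠ 0) :
    ∃ n, m = n + Finsupp.single i 1 :=
  ⟨m - Finsupp.single i 1, (tsub_add_cancel_of_le
    (Finsupp.single_le_iff.2 (Nat.one_le_iff_ne_zero.2 h))).symm⟩

/-- If `k` and `l` are connected in the subgraph induced on `W`, then every monomial divisible by a
variable of each vertex in `W ∖ {k, l}` multiplies the binomial of `k` and `l` into the ideal: along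
a path, use `x_a f_{kl} = x_k f_{al} + x_l f_{ka}` and `y_a f_{kl} = y_k f_{al} + y_l f_{ka}`. -/
lemma monomial_mul_edgeBinomial_mem {H : SimpleGraph V} {W : Set V} {k l : V}
    (h : (supportGraph H W).Reachable k l) (n : (V ⊕ V) →₀ ℕ)
    (hn : ∀ v ∈ W, v = k ∨ v = l ∨ mdeg n v ≠ 0) :
    monomial n 1 * edgeBinomial K k l ∈ binomialEdgeIdeal K H := by
  rw [SimpleGraph.reachable_iff_reflTransGen] at h
  induction h using Relation.ReflTransGen.head_induction_on generalizing n with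
  | refl => rw [edgeBinomial_self, mul_zero]; exact zero_mem _
  | @head k a hka _ ih =>
    by_cases hal : a = l
    · subst hal
      exact Ideal.mul_mem_left _ _ (edgeBinomial_mem hka.1)
    have hna : mdeg n a ≠ 0 :=
      ((hn a hka.2.2).resolve_left hka.1.ne').resolve_left hal
    have step : ∀ i j : V ⊕ V, Sum.elim id id i = a → Sum.elim id id j = k → n i ≠ 0 →
        X j * edgeBinomial K a l - X i * edgeBinomial K k l ∈ binomialEdgeIdeal K H →
        monomial n 1 * edgeBinomial K k l ∈ binomialEdgeIdeal K H := by
      intro i j hi hj hni hmem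
      obtain ⟨n', rfl⟩ : ∃ n', n = n' + Finsupp.single i 1 :=
      exists_eq_add_single hni
      have h1 := ih (n' + Finsupp.single j 1) (by
        intro v hv
        rcases hn v hv with h | h | h
        · right; right
          rw [map_add, mdeg_single, vertexWeight, hj, h, Finsupp.add_apply,
            Finsupp.single_eq_same]
          omega
        · exact Or.inr (Or.inl h)
        · by_cases hva : v = a
          · exact Or.inl hva
          · right; right
            rw [map_add, mdeg_single, vertexWeight, hi, Finsupp.add_apply,
              Finsupp.single_eq_of_ne hva, add_zero] at h
            rw [map_add, Finsupp.add_apply]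
            omega)
      have e : ∀ q : V ⊕ V, monomial (n' + Finsupp.single q 1) (1 : K) =
          monomial n' 1 * X q := by
        intro q
        rw [X, monomial_mul, one_mul]
      rw [e] at h1 ⊢
      have h2 := Ideal.mul_mem_left _ (monomial n' (1 : K)) hmem
      have h3 := sub_mem h1 h2
      have h4 : monomial n' 1 * X j * edgeBinomial K a l - monomial n' 1 *
          (X j * edgeBinomial K a l - X i * edgeBinomial K k l) =
          monomial n' 1 * X i * edgeBinomial K k l := by ring
      rwa [h4] at h3
    have hmem := edgeBinomial_mem (K := K) hka.1
    rw [mdeg_apply] at hna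
    -- the vertex `a` contributes `x_a` or `y_a` to the monomial
    by_cases hx : n (Sum.inl a) = 0
    · refine step (Sum.inr a) (Sum.inr k) rfl rfl (by omega) ?_
      have h5 : X (Sum.inr k) * edgeBinomial K a l - X (Sum.inr a) * edgeBinomial K k l =
          -X (Sum.inr l) * edgeBinomial K k a := by
        unfold edgeBinomial; ring
      rw [h5]
      exact Ideal.mul_mem_left _ _ hmem
    · refine step (Sum.inl a) (Sum.inl k) rfl rfl hx ?_
      have h5 : X (Sum.inl k) * edgeBinomial K a l - X (Sum.inl a) * edgeBinomial K k l =
          -X (Sum.inl l) * edgeBinomial K k a := by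
        unfold edgeBinomial; ring
      rw [h5]
      exact Ideal.mul_mem_left _ _ hmem

lemma exists_of_mapDomain_ne_zero {α β : Type*} (f : α → β) (m : α →₀ ℕ) (b : β)
    (h : Finsupp.mapDomain f m b ≠ 0) : ∃ a, f a = b ∧ m a ≠ 0 := by
  classical
  have := Finsupp.mapDomain_support (Finsupp.mem_support_iff.2 h)
  obtain ⟨a, ha, hab⟩ := Finset.mem_image.1 this
  exact ⟨a, hab, Finsupp.mem_support_iff.1 ha⟩

lemma mapDomain_ne_zero_of_ne_zero {α β : Type*} (f : α → β) (m : α →₀ ℕ) (a : α)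
    (h : m a ≠ 0) : Finsupp.mapDomain f m (f a) ≠ 0 := by
  obtain ⟨m', rfl⟩ : ∃ m', m = m' + Finsupp.single a 1 :=
      exists_eq_add_single h
  rw [Finsupp.mapDomain_add, Finsupp.mapDomain_single, Finsupp.add_apply, Finsupp.single_eq_same]
  omega

/-- Two monomials of the same multidegree are congruent modulo the ideal as soon as they contain
the same number of `x`-variables in each connected component of the induced subgraph on the support
of the multidegree. The components are recorded by `κ`. -/
lemma monomial_sub_monomial_mem {H : SimpleGraph V} {W : Set V} (κ : V → Q)
    (hκ : ∀ v ∈ W, ∀ w ∈ W, κ v = κ w → (supportGraph H W).Reachable v w)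
    (m m' n : (V ⊕ V) →₀ ℕ) (hdeg : mdeg m = mdeg m')
    (hmap : m.mapDomain (Sum.map κ κ) = m'.mapDomain (Sum.map κ κ))
    (hW : ∀ v, v ∈ W ↔ mdeg (n + m) v ≠ 0) :
    monomial (n + m) (1 : K) - monomial (n + m') 1 ∈ binomialEdgeIdeal K H := by
  induction hk : m.degree using Nat.strong_induction_on generalizing m m' n with
  | _ k ih =>
  subst hk
  by_cases hx : ∀ v, m (Sum.inl v) = 0
  · have hx' : ∀ v, m' (Sum.inl v) = 0 := by
      intro v
      by_contra h
      have h1 := mapDomain_ne_zero_of_ne_zero (Sum.map κ κ) m' _ h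
      rw [← hmap] at h1
      obtain ⟨a, ha, ha'⟩ := exists_of_mapDomain_ne_zero _ _ _ h1
      rcases a with a | a
      · exact ha' (hx a)
      · simp at ha
    have : m = m' := by
      ext i
      rcases i with v | v
      · rw [hx, hx']
      · have := DFunLike.congr_fun hdeg v
        rw [mdeg_apply, mdeg_apply, hx, hx'] at this
        omega
    rw [this, sub_self]
    exact zero_mem _
  push Not at hx
  obtain ⟨v, hv⟩ := hx
  -- a common factor `x_v` is moved to the monomial `n`
  have common : ∀ m₁ m₁' : (V ⊕ V) →₀ ℕ, m = m₁ + Finsupp.single (Sum.inl v) 1 →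
      mdeg m = mdeg (m₁' + Finsupp.single (Sum.inl v) 1) →
      m.mapDomain (Sum.map κ κ) =
        (m₁' + Finsupp.single (Sum.inl v) 1).mapDomain (Sum.map κ κ) →
      monomial (n + m) (1 : K) - monomial (n + (m₁' + Finsupp.single (Sum.inl v) 1)) 1 ∈
        binomialEdgeIdeal K H := by
    rintro m₁ m₁' rfl h1 h2
    rw [map_add, map_add, add_left_inj] at h1
    rw [Finsupp.mapDomain_add, Finsupp.mapDomain_add, add_left_inj] at h2
    have h3 : ∀ q : (V ⊕ V) →₀ ℕ, n + (q + Finsupp.single (Sum.inl v) 1) =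
        n + Finsupp.single (Sum.inl v) 1 + q := fun q => by
      rw [add_assoc, add_comm q]
    rw [h3, h3]
    refine ih m₁.degree ?_ m₁ m₁' (n + Finsupp.single (Sum.inl v) 1) h1 h2 ?_ rfl
    · rw [map_add, Finsupp.degree_single]
      omega
    · intro z
      rw [← h3]
      exact hW z
  obtain ⟨m₁, hm₁⟩ : ∃ m₁, m = m₁ + Finsupp.single (Sum.inl v) 1 :=
      exists_eq_add_single hv
  by_cases hv' : m' (Sum.inl v) = 0
  · have h1 := mapDomain_ne_zero_of_ne_zero (Sum.map κ κ) m _ hv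
    rw [hmap] at h1
    obtain ⟨w, hw, hmw⟩ := exists_of_mapDomain_ne_zero _ _ _ h1
    obtain ⟨w, rfl⟩ : ∃ w', w = Sum.inl w' := by
      rcases w with w | w
      · exact ⟨w, rfl⟩
      · simp at hw
    have hκw : κ w = κ v := by simpa using hw
    have hyv : m' (Sum.inr v) ≠ 0 := by
      have := DFunLike.congr_fun hdeg v
      rw [mdeg_apply, mdeg_apply, hv'] at this
      omega
    obtain ⟨m₂, rfl⟩ : ∃ m₂, m' = m₂ + Finsupp.single (Sum.inl w) 1 :=
      exists_eq_add_single hmw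
    have hyv' : m₂ (Sum.inr v) ≠ 0 := by
      rwa [Finsupp.add_apply, Finsupp.single_eq_of_ne (by simp), add_zero] at hyv
    obtain ⟨m₃, rfl⟩ : ∃ m₃, m₂ = m₃ + Finsupp.single (Sum.inr v) 1 :=
      exists_eq_add_single hyv'
    have hWv : v ∈ W := by
      rw [hW, map_add, Finsupp.add_apply, mdeg_apply m]
      omega
    have hWw : w ∈ W := by
      rw [hW, map_add, Finsupp.add_apply, hdeg, mdeg_apply (_ + _)]
      omega
    have hmove := monomial_mul_edgeBinomial_mem (K := K) (hκ w hWw v hWv hκw) (n + m₃) (by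
      intro z hz
      rw [hW, map_add, hdeg] at hz
      by_cases h1 : z = w
      · exact Or.inl h1
      by_cases h2 : z = v
      · exact Or.inr (Or.inl h2)
      right; right
      simp only [map_add, mdeg_single, vertexWeight, Finsupp.add_apply, Sum.elim_inl,
        Sum.elim_inr, id, Finsupp.single_eq_of_ne h1, Finsupp.single_eq_of_ne h2] at hz ⊢
      omega)
    have h2 := common m₁ (m₃ + Finsupp.single (Sum.inr w) 1) hm₁
      (by
        rw [hdeg]
        simp only [map_add, mdeg_single, vertexWeight, Sum.elim_inl, Sum.elim_inr]
        abel)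
      (by
        rw [hmap]
        simp only [Finsupp.mapDomain_add, Finsupp.mapDomain_single, Sum.map_inl, Sum.map_inr, hκw])
    have h3 : monomial (n + m) (1 : K) - monomial
          (n + (m₃ + Finsupp.single (Sum.inr v) 1 + Finsupp.single (Sum.inl w) 1)) 1 =
        (monomial (n + m) (1 : K) - monomial
          (n + (m₃ + Finsupp.single (Sum.inr w) 1 + Finsupp.single (Sum.inl v) 1)) 1) -
        monomial (n + m₃) 1 * edgeBinomial K w v := by
      have e : ∀ (q : (V ⊕ V) →₀ ℕ) (i : V ⊕ V),
          monomial (q + Finsupp.single i 1) (1 : K) = monomial q 1 * X i := by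
        intro q i
        rw [X, monomial_mul, one_mul]
      rw [← add_assoc n, ← add_assoc n, ← add_assoc n, ← add_assoc n, e, e, e, e, edgeBinomial]
      ring
    rw [h3]
    exact sub_mem h2 hmove
  · obtain ⟨m₁', rfl⟩ : ∃ m₁', m' = m₁' + Finsupp.single (Sum.inl v) 1 :=
      exists_eq_add_single hv'
    exact common m₁ m₁' hm₁ hdeg hmap

/-- The membership criterion, one direction: a multihomogeneous polynomial whose variables vanish
after identification of the vertices in the same component lies in the ideal. -/
lemma mem_of_rename_eq_zero {H : SimpleGraph V} (κ : V → Q) {u : V →₀ ℕ}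
    (hκ : ∀ v, u v ≠ 0 → ∀ w, u w ≠ 0 → κ v = κ w →
      (supportGraph H {v | u v ≠ 0}).Reachable v w)
    {g : MvPolynomial (V ⊕ V) K} (hg : IsWeightedHomogeneous vertexWeight g u)
    (h0 : rename (Sum.map κ κ) g = 0) : g ∈ binomialEdgeIdeal K H := by
  classical
  let q : MvPolynomial (V ⊕ V) K →ₗ[K] MvPolynomial (V ⊕ V) K ⧸ binomialEdgeIdeal K H :=
    (Ideal.Quotient.mkₐ K _).toLinearMap
  -- in degree `u` the class of a monomial depends only on its image, so the quotient map factors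
  let θ : ((Q ⊕ Q) →₀ ℕ) → MvPolynomial (V ⊕ V) K ⧸ binomialEdgeIdeal K H := fun n =>
    if h : ∃ m : (V ⊕ V) →₀ ℕ, mdeg m = u ∧ m.mapDomain (Sum.map κ κ) = n then
      q (monomial h.choose 1) else 0
  have hθ : ∀ m : (V ⊕ V) →₀ ℕ, mdeg m = u →
      θ (m.mapDomain (Sum.map κ κ)) = q (monomial m 1) := by
    intro m hm
    have h : ∃ m' : (V ⊕ V) →₀ ℕ, mdeg m' = u ∧
      m'.mapDomain (Sum.map κ κ) = m.mapDomain (Sum.map κ κ) := ⟨m, hm, rfl⟩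
    change (if h : _ then _ else _) = _
    rw [dif_pos h]
    refine Ideal.Quotient.eq.2 ?_
    have := monomial_sub_monomial_mem (K := K) (H := H) (W := {v | u v ≠ 0}) κ
      (fun v hv w hw => hκ v hv w hw) h.choose m 0 (h.choose_spec.1.trans hm.symm)
      h.choose_spec.2 (fun v => by rw [zero_add, h.choose_spec.1]; rfl)
    rwa [zero_add, zero_add] at this
  let Θ := (basisMonomials (Q ⊕ Q) K).constr K θ
  have hΘ : ∀ n c, Θ (monomial n c) = c • θ n := by
    intro n c
    have h1 : (monomial n c : MvPolynomial (Q ⊕ Q) K) = c • basisMonomials (Q ⊕ Q) K n := by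
      rw [coe_basisMonomials, smul_monomial, smul_eq_mul, mul_one]
    rw [h1, map_smul, Module.Basis.constr_basis]
  have h1 : Θ (rename (Sum.map κ κ) g) = q g := by
    conv_lhs => rw [g.as_sum]
    conv_rhs => rw [g.as_sum]
    rw [map_sum, map_sum, map_sum]
    refine Finset.sum_congr rfl fun m hm => ?_
    rw [rename_monomial, hΘ, hθ m (hg (mem_support_iff.1 hm)), ← map_smul, smul_monomial,
      smul_eq_mul, mul_one]
  rw [h0, map_zero] at h1
  exact Ideal.Quotient.eq_zero_iff_mem.1 h1.symm

/-- The membership criterion, the other direction. -/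
lemma rename_component_eq_zero {H : SimpleGraph V} (κ : V → Q) {u : V →₀ ℕ}
    (hκ : ∀ v w, u v ≠ 0 → u w ≠ 0 → H.Adj v w → κ v = κ w)
    {p : MvPolynomial (V ⊕ V) K} (hp : p ∈ binomialEdgeIdeal K H) :
    rename (Sum.map κ κ) (weightedHomogeneousComponent vertexWeight u p) = 0 := by
  classical
  have key : ∀ s, rename (Sum.map κ κ)
      (weightedHomogeneousComponent vertexWeight u (s * p)) = 0 := by
    refine Submodule.span_induction (p := fun p _ => ∀ s, rename (Sum.map κ κ)
      (weightedHomogeneousComponent vertexWeight u (s * p)) = 0) ?_ ?_ ?_ ?_ hp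
    · rintro _ ⟨i, j, hij, rfl⟩ s
      change rename _ (weightedHomogeneousComponent _ _ (s * edgeBinomial K i j)) = 0
      induction s using MvPolynomial.induction_on' with
      | monomial m a =>
        have hm := (isWeightedHomogeneous_monomial (R := K) vertexWeight m a rfl).mul
          (edgeBinomial_isWeightedHomogeneous (K := K) i j)
        rw [weightedHomogeneousComponent_of_mem hm]
        split_ifs with h
        · have h1 : u i ≠ 0 := by simp [h]
          have h2 : u j ≠ 0 := by simp [h]
          rw [map_mul]
          simp [edgeBinomial, hκ i j h1 h2 hij]
        · exact map_zero _
      | add s t hs ht => rw [add_mul, map_add, map_add, hs, ht, add_zero]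
    · intro s
      rw [mul_zero, map_zero, map_zero]
    · intro x y _ _ hx hy s
      rw [mul_add, map_add, map_add, hx, hy, add_zero]
    · intro t x _ hx s
      rw [smul_eq_mul, ← mul_assoc]
      exact hx _
  simpa using key 1

lemma weightedHomogeneousComponent_mul {f : MvPolynomial (V ⊕ V) K} {e : V →₀ ℕ}
    (hf : IsWeightedHomogeneous vertexWeight f e) (p : MvPolynomial (V ⊕ V) K) (u : V →₀ ℕ) :
    weightedHomogeneousComponent vertexWeight (u + e) (f * p) =
      f * weightedHomogeneousComponent vertexWeight u p := by
  classical
  induction p using MvPolynomial.induction_on' with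
  | monomial m a =>
    have hm := isWeightedHomogeneous_monomial (R := K) vertexWeight m a rfl
    rw [weightedHomogeneousComponent_of_mem (hf.mul hm), weightedHomogeneousComponent_of_mem hm]
    by_cases h : u = mdeg m
    · rw [if_pos h, if_pos (by rw [h, add_comm])]
    · rw [if_neg h, if_neg (by rw [add_comm e]; exact fun h' => h (add_right_cancel h')), mul_zero]
  | add p q hp hq => rw [mul_add, map_add, hp, hq, map_add, mul_add]

lemma mem_of_forall_component_mem {I : Ideal (MvPolynomial (V ⊕ V) K)}
    {p : MvPolynomial (V ⊕ V) K}
    (h : ∀ u, weightedHomogeneousComponent vertexWeight u p ∈ I) : p ∈ I := by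
  rw [← sum_weightedHomogeneousComponent vertexWeight p,
    finsum_eq_sum _ (weightedHomogeneousComponent_finsupp p)]
  exact I.sum_mem fun u _ => h u

/-- Adding a vertex whose neighbourhood is a clique does not connect other vertices. -/
lemma reachable_of_reachable_insert {H : SimpleGraph V} {W : Set V} {i : V}
    (hi : H.IsClique (H.neighborSet i)) {v w : V} (hv : v ∈ W) (hw : w ∈ W)
    (h : (supportGraph H (insert i W)).Reachable v w) :
    (supportGraph H W).Reachable v w := by
  by_cases hiW : i ∈ W
  · rwa [Set.insert_eq_of_mem hiW] at h
  rw [SimpleGraph.reachable_iff_reflTransGen] at h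
  have key : ∀ x, Relation.ReflTransGen (supportGraph H (insert i W)).Adj v x →
      (x ∈ W → (supportGraph H W).Reachable v x) ∧
      (x = i → ∃ y ∈ W, H.Adj i y ∧ (supportGraph H W).Reachable v y) := by
    intro x hx
    induction hx with
    | refl => exact ⟨fun _ => SimpleGraph.Reachable.refl _, fun h => absurd (h ▸ hv) hiW⟩
    | @tail x z _ hxz ih =>
      obtain ⟨hadj, hx, hz⟩ := hxz
      rcases Set.mem_insert_iff.1 hx with rfl | hxW
      · obtain ⟨y, hyW, hy, hvy⟩ := ih.2 rfl
        refine ⟨fun hzW => ?_, fun h => absurd h hadj.ne'⟩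
        by_cases hyz : y = z
        · exact hyz ▸ hvy
        · exact hvy.trans (SimpleGraph.Adj.reachable
            (show (supportGraph H W).Adj y z from ⟨hi hy hadj hyz, hyW, hzW⟩))
      · exact ⟨fun hzW => (ih.1 hxW).trans (SimpleGraph.Adj.reachable
          (show (supportGraph H W).Adj x z from ⟨hadj, hxW, hzW⟩)),
          fun h => ⟨x, hxW, h ▸ hadj.symm, ih.1 hxW⟩⟩
  exact (key w h).1 hw

lemma rename_edgeBinomial_ne_zero {κ : V → Q} {i j : V} (h : κ i ≠ κ j) :
    rename (Sum.map κ κ) (edgeBinomial K i j) ≠ 0 := by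
  classical
  intro h0
  have h1 := congrArg (MvPolynomial.aeval
    (Sum.elim (fun a => if a = κ i then (1 : K) else 0) (fun a => if a = κ j then 1 else 0))) h0
  simp [edgeBinomial, Ne.symm h] at h1

/-- If `i` and `j` lie in different components of `H` and the neighbourhood of each is a clique,
then the binomial of `i` and `j` is a nonzerodivisor modulo `J_H`. In a given multidegree the ideal
is the kernel of a map to a domain, which sees only the components of the subgraph induced on the
support; these are not changed when `i` and `j` are added to the support. -/
theorem mem_of_edgeBinomial_mul_mem {H : SimpleGraph V} {i j : V} (hij : ¬ H.Reachable i j)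
    (hi : H.IsClique (H.neighborSet i)) (hj : H.IsClique (H.neighborSet j))
    {p : MvPolynomial (V ⊕ V) K} (hp : edgeBinomial K i j * p ∈ binomialEdgeIdeal K H) :
    p ∈ binomialEdgeIdeal K H := by
  refine mem_of_forall_component_mem fun u => ?_
  set e : V →₀ ℕ := Finsupp.single i 1 + Finsupp.single j 1 with he
  set W : Set V := {v | u v ≠ 0} with hW
  have hW' : ∀ v, (u + e) v ≠ 0 ↔ v ∈ insert i (insert j W) := by
    intro v
    by_cases h1 : v = i
    · simp [he, h1]
    by_cases h2 : v = j
    · simp [he, h2]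
    simp [he, h1, h2, hW]
  let κ := (supportGraph H (insert i (insert j W))).connectedComponentMk
  have hκ : ∀ v w, κ v = κ w ↔ (supportGraph H (insert i (insert j W))).Reachable v w :=
    fun v w => SimpleGraph.ConnectedComponent.eq
  have h1 := rename_component_eq_zero (u := u + e) κ (fun v w hv hw hvw => by
    rw [hκ]
    exact SimpleGraph.Adj.reachable ⟨hvw, (hW' v).1 hv, (hW' w).1 hw⟩) hp
  rw [weightedHomogeneousComponent_mul (edgeBinomial_isWeightedHomogeneous i j), map_mul] at h1
  have hle : supportGraph H (insert i (insert j W)) ≤ H := fun _ _ h => h.1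
  have h2 := (mul_eq_zero.1 h1).resolve_left (rename_edgeBinomial_ne_zero fun h =>
    hij (((hκ i j).1 h).mono hle))
  refine mem_of_rename_eq_zero κ (fun v hv w hw hvw => ?_)
    (weightedHomogeneousComponent_isWeightedHomogeneous u p) h2
  exact reachable_of_reachable_insert hj hv hw (reachable_of_reachable_insert hi
    (Set.mem_insert_of_mem _ hv) (Set.mem_insert_of_mem _ hw) ((hκ v w).1 hvw))

end Multigrading

/-! ### Operations on graphs and their binomial edge ideals -/

lemma HasResolutionLE.mono {σ K : Type*} [Field K] {I : Ideal (MvPolynomial σ K)} {r s : ℕ}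
    (h : HasResolutionLE I r) (hrs : r ≤ s) : HasResolutionLE I s := by
  obtain ⟨F, hF⟩ := h
  exact ⟨F, fun b => (hF b).trans (by omega)⟩

section Graphs

variable {U V K : Type*} [Field K]

lemma constantCoeff_of_mem {H : SimpleGraph V} {f : MvPolynomial (V ⊕ V) K}
    (hf : f ∈ binomialEdgeIdeal K H) : constantCoeff f = 0 := by
  have : binomialEdgeIdeal K H ≤ RingHom.ker (constantCoeff (σ := V ⊕ V) (R := K)) := by
    refine Ideal.span_le.2 ?_
    rintro _ ⟨i, j, -, rfl⟩
    simp [RingHom.mem_ker]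
  exact this hf

lemma binomialEdgeIdeal_bot : binomialEdgeIdeal K (⊥ : SimpleGraph V) = ⊥ := by
  refine Ideal.span_eq_bot.2 ?_
  rintro _ ⟨i, j, h, -⟩
  exact h.elim

lemma binomialEdgeIdeal_sup (G H : SimpleGraph V) :
    binomialEdgeIdeal K (G ⊔ H) = binomialEdgeIdeal K G ⊔ binomialEdgeIdeal K H := by
  refine le_antisymm (Ideal.span_le.2 ?_) (sup_le (Ideal.span_le.2 ?_) (Ideal.span_le.2 ?_))
  · rintro _ ⟨i, j, h | h, rfl⟩
    · exact Ideal.mem_sup_left (edgeBinomial_mem h)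
    · exact Ideal.mem_sup_right (edgeBinomial_mem h)
  · rintro _ ⟨i, j, h, rfl⟩
    exact edgeBinomial_mem (Or.inl h)
  · rintro _ ⟨i, j, h, rfl⟩
    exact edgeBinomial_mem (Or.inr h)

lemma binomialEdgeIdeal_edge {i j : V} (h : i ≠ j) :
    binomialEdgeIdeal K (SimpleGraph.edge i j) = Ideal.span {edgeBinomial K i j} := by
  refine le_antisymm (Ideal.span_le.2 ?_) (Ideal.span_le.2 ?_)
  · rintro _ ⟨a, b, hab, rfl⟩
    rcases (SimpleGraph.edge_adj ..).1 hab with ⟨⟨rfl, rfl⟩ | ⟨rfl, rfl⟩, -⟩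
    · exact Ideal.mem_span_singleton_self _
    · have := neg_mem (Ideal.mem_span_singleton_self (edgeBinomial K b a))
      rwa [edgeBinomial, neg_sub] at this
  · rintro _ rfl
    exact edgeBinomial_mem ((SimpleGraph.edge_adj ..).2 ⟨Or.inl ⟨rfl, rfl⟩, h⟩)

lemma binomialEdgeIdeal_map (f : U ↪ V) (H : SimpleGraph U) :
    binomialEdgeIdeal K (H.map f) = (binomialEdgeIdeal K H).map
      (rename (Sum.map f f) : MvPolynomial (U ⊕ U) K →ₐ[K] MvPolynomial (V ⊕ V) K) := by
  refine le_antisymm (Ideal.span_le.2 ?_) (Ideal.map_le_iff_le_comap.2 (Ideal.span_le.2 ?_))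
  · rintro _ ⟨_, _, h, rfl⟩
    obtain ⟨i, j, hij, rfl, rfl⟩ := (SimpleGraph.map_adj ..).1 h
    have := Ideal.mem_map_of_mem
      (rename (Sum.map f f) : MvPolynomial (U ⊕ U) K →ₐ[K] MvPolynomial (V ⊕ V) K)
      (edgeBinomial_mem (K := K) hij)
    simpa [edgeBinomial] using this
  · rintro _ ⟨i, j, hij, rfl⟩
    have := edgeBinomial_mem (K := K) (H := H.map f) (i := f i) (j := f j)
      ((SimpleGraph.map_adj ..).2 ⟨i, j, hij, rfl, rfl⟩)
    simpa [edgeBinomial] using this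

lemma exists_sum_equiv {σ τ : Type*} (f : σ → τ) (hf : Function.Injective f) :
    ∃ e : ((Set.range f)ᶜ : Set τ) ⊕ σ ≃ τ, e ∘ Sum.inr = f ∧ e ∘ Sum.inl = Subtype.val := by
  classical
  refine ⟨(Equiv.sumComm _ _).trans ((Equiv.sumCongr (Equiv.ofInjective f hf)
    (Equiv.refl _)).trans (Equiv.Set.sumCompl (Set.range f))), ?_, ?_⟩ <;>
  · ext x
    simp

/-- Disjoint unions of graphs. -/
lemma HasResolutionLE.map_sup {f : U ↪ V} {H₁ : SimpleGraph U} {H₂ : SimpleGraph V} {r s : ℕ}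
    (h₁ : HasResolutionLE (binomialEdgeIdeal K H₁) r)
    (h₂ : HasResolutionLE (binomialEdgeIdeal K H₂) s)
    (hdisj : ∀ a b, H₂.Adj a b → a ∉ Set.range f) :
    HasResolutionLE (binomialEdgeIdeal K (H₁.map f ⊔ H₂)) (r + s) := by
  obtain ⟨e, her, hel⟩ := exists_sum_equiv (Sum.map f f)
    (Sum.map_injective.2 ⟨f.injective, f.injective⟩)
  let φ : MvPolynomial _ K →ₐ[K] MvPolynomial (V ⊕ V) K := rename (e ∘ Sum.inl)
  have hJ : ((binomialEdgeIdeal K H₂).comap φ).map φ = binomialEdgeIdeal K H₂ := by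
    refine le_antisymm Ideal.map_comap_le (Ideal.span_le.2 ?_)
    rintro _ ⟨i, j, hij, rfl⟩
    have hl : ∀ k, k ∉ Set.range f → Sum.inl k ∈ (Set.range (Sum.map f f))ᶜ := by
      rintro k hk ⟨a | a, ha⟩
      · exact hk ⟨a, Sum.inl_injective ha⟩
      · simp at ha
    have hr : ∀ k, k ∉ Set.range f → Sum.inr k ∈ (Set.range (Sum.map f f))ᶜ := by
      rintro k hk ⟨a | a, ha⟩
      · simp at ha
      · exact hk ⟨a, Sum.inr_injective ha⟩
    have hi := hdisj i j hij
    have hj := hdisj j i hij.symm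
    have hφ : φ (X ⟨_, hl i hi⟩ * X ⟨_, hr j hj⟩ - X ⟨_, hl j hj⟩ * X ⟨_, hr i hi⟩) =
        edgeBinomial K i j := by
      simp only [φ, hel, map_sub, map_mul, rename_X]
      rfl
    change edgeBinomial K i j ∈ _
    rw [← hφ]
    refine Ideal.mem_map_of_mem _ (Ideal.mem_comap.2 ?_)
    rw [hφ]
    exact edgeBinomial_mem hij
  rw [binomialEdgeIdeal_sup, binomialEdgeIdeal_map, ← her, ← hJ]
  refine h₁.map_sup_map e ?_
  change HasResolutionLE (((binomialEdgeIdeal K H₂).comap φ).map φ) s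
  rwa [hJ]

/-- Adding an edge between vertices of different components whose neighbourhoods are cliques. -/
lemma HasResolutionLE.sup_edge {H : SimpleGraph V} {i j : V} {r : ℕ}
    (h : HasResolutionLE (binomialEdgeIdeal K H) r) (hij : ¬ H.Reachable i j)
    (hi : H.IsClique (H.neighborSet i)) (hj : H.IsClique (H.neighborSet j)) :
    HasResolutionLE (binomialEdgeIdeal K (H ⊔ SimpleGraph.edge i j)) (r + 1) := by
  have hne : i ≠ j := fun h => hij (h ▸ SimpleGraph.Reachable.refl _)
  rw [binomialEdgeIdeal_sup, binomialEdgeIdeal_edge hne]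
  refine h.sup_span_singleton (k := 1) ?_ ?_ fun g => mem_of_edgeBinomial_mul_mem hij hi hj
  · exact ((isHomogeneous_X _ _).mul (isHomogeneous_X _ _)).sub
      ((isHomogeneous_X _ _).mul (isHomogeneous_X _ _))
  · intro h0
    exact rename_edgeBinomial_ne_zero (K := K) (κ := id) hne (by rw [h0, map_zero])

end Graphs

/-! ### Maximal cliques and free cut edges -/

section Cliques

variable {V : Type*} {G : SimpleGraph V}

/-- The number of maximal cliques with at least two vertices. -/
noncomputable def numNontrivialMaximalCliques (G : SimpleGraph V) : ℕ :=
  {s : Set V | Maximal G.IsClique s ∧ s.Nontrivial}.ncard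

lemma not_adj_of_isBridge {a b x : V} (h : G.IsBridge s(a, b)) (ha : G.Adj a x)
    (hb : G.Adj b x) : False := by
  rw [SimpleGraph.isBridge_iff] at h
  refine h (SimpleGraph.Reachable.trans (v := x) (SimpleGraph.Adj.reachable ?_)
    (SimpleGraph.Adj.reachable ?_))
  · rw [SimpleGraph.deleteEdges_adj]
    refine ⟨ha, fun h' => ?_⟩
    rcases Sym2.eq_iff.1 (Set.mem_singleton_iff.1 h') with ⟨-, h2⟩ | ⟨h2, h3⟩
    · exact hb.ne h2.symm
    · exact ha.ne h3.symm
  · rw [SimpleGraph.deleteEdges_adj]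
    refine ⟨hb.symm, fun h' => ?_⟩
    rcases Sym2.eq_iff.1 (Set.mem_singleton_iff.1 h') with ⟨h2, -⟩ | ⟨h2, h3⟩
    · exact ha.ne h2.symm
    · exact hb.ne h2.symm

lemma IsFreeVertex.isClique_neighborSet [Finite V] {v : V} (h : IsFreeVertex G v) :
    G.IsClique (G.neighborSet v) := by
  obtain ⟨s, -, hs⟩ := h
  have key : ∀ a, G.Adj v a → a ∈ s := by
    intro a ha
    obtain ⟨t, ht, ht'⟩ := Finite.exists_le_maximal (p := G.IsClique) (a := ({v, a} : Set V))
      (by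
        rw [SimpleGraph.isClique_pair]
        exact fun _ => ha)
    rw [← hs t ⟨ht', ht (by simp)⟩]
    exact ht (by simp)
  have hv : ∃ t, Maximal G.IsClique t ∧ v ∈ t := by
    obtain ⟨t, ht, ht'⟩ := Finite.exists_le_maximal (p := G.IsClique) (a := ({v} : Set V))
      (SimpleGraph.isClique_singleton v)
    exact ⟨t, ht', ht rfl⟩
  obtain ⟨t, ht, hvt⟩ := hv
  obtain rfl := hs t ⟨ht, hvt⟩
  intro a ha b hb hab
  exact ht.prop (key a ha) (key b hb) hab

lemma numNontrivialMaximalCliques_eq [Finite V] (hG : G.Connected) (hne : G ≠ ⊥) :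
    numNontrivialMaximalCliques G = numMaximalCliques G := by
  unfold numNontrivialMaximalCliques numMaximalCliques
  congr 1
  ext s
  refine ⟨fun h => h.1, fun h => ⟨h, ?_⟩⟩
  by_contra hs
  rw [Set.not_nontrivial_iff] at hs
  obtain ⟨a, b, hab⟩ := SimpleGraph.ne_bot_iff_exists_adj.1 hne
  have hadj : ∀ v, ∃ w, G.Adj v w := by
    intro v
    obtain ⟨w, hw⟩ : ∃ w, v ≠ w := by
      by_cases h : v = a
      · exact ⟨b, h ▸ hab.ne⟩
      · exact ⟨a, h⟩
    have hr := hG.preconnected v w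
    rw [SimpleGraph.reachable_iff_reflTransGen] at hr
    rcases hr.cases_head with h | ⟨c, hc, -⟩
    · exact absurd h hw
    · exact ⟨c, hc⟩
  rcases s.eq_empty_or_nonempty with rfl | ⟨v, hv⟩
  · exact (h.2 (SimpleGraph.isClique_singleton a) (Set.empty_subset _) rfl).elim
  · obtain ⟨w, hw⟩ := hadj v
    have h1 : s ⊆ {v, w} := fun x hx => by simp [hs hx hv]
    have h2 := h.2 (y := {v, w}) (by
      rw [SimpleGraph.isClique_pair]
      exact fun _ => hw) h1 (show w ∈ ({v, w} : Set V) by simp)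
    exact hw.ne (hs hv h2)

/-- The image of a nontrivial maximal clique of a component of the reduced graph is a maximal clique
of `G`: a vertex that extends it would lie on a triangle, and the free cut edges are bridges. -/
lemma maximal_image_clique (R : (reducedGraph G).ConnectedComponent) {s : Set R}
    (hs : Maximal R.toSimpleGraph.IsClique s) (hs' : s.Nontrivial) :
    Maximal G.IsClique (Subtype.val '' s) := by
  have hle : reducedGraph G ≤ G := SimpleGraph.deleteEdges_le _
  have hadj : ∀ x ∈ s, ∀ y ∈ s, x ≠ y → (reducedGraph G).Adj x y := fun x hx y hy hxy =>
    hs.prop hx hy hxy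
  refine ⟨?_, fun t ht hst x hx => ?_⟩
  · rintro _ ⟨x, hx, rfl⟩ _ ⟨y, hy, rfl⟩ hxy
    exact hle (hadj x hx y hy fun h => hxy (congrArg _ h))
  · by_contra hxs
    have h1 : ∀ y ∈ s, (reducedGraph G).Adj x y := by
      intro y hy
      have hG : ∀ z ∈ s, G.Adj x z := fun z hz => ht hx (hst ⟨z, hz, rfl⟩)
        (fun h => hxs ⟨z, hz, h.symm⟩)
      by_contra hne
      have hfree : IsFreeCutEdge G s(x, (y : V)) := by
        by_contra hn
        exact hne ((SimpleGraph.deleteEdges_adj ..).2 ⟨hG y hy, hn⟩)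
      obtain ⟨z, hz, hzy⟩ := hs'.exists_ne y
      exact not_adj_of_isBridge hfree.2.1 (hG z hz) (hle (hadj y hy z hz hzy.symm))
    obtain ⟨y, hy⟩ := hs'.nonempty
    have hxR : x ∈ R :=
      (SimpleGraph.ConnectedComponent.connectedComponentMk_eq_of_adj (h1 y hy)).trans y.2
    refine hxs ⟨⟨x, hxR⟩, hs.2 (y := insert ⟨x, hxR⟩ s) ?_ (Set.subset_insert _ _)
      (Set.mem_insert _ _), rfl⟩
    exact (SimpleGraph.isClique_insert ..).2 ⟨hs.prop, fun b hb _ => h1 b hb⟩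

/-- The nontrivial maximal cliques of the components of the reduced graph and the free cut edges
are different maximal cliques of `G`. -/
lemma sum_numNontrivialMaximalCliques_add_le [Finite V] (G : SimpleGraph V)
    [Fintype (reducedGraph G).ConnectedComponent] :
    ∑ R : (reducedGraph G).ConnectedComponent, numNontrivialMaximalCliques R.toSimpleGraph +
      {e | IsFreeCutEdge G e}.ncard ≤ numMaximalCliques G := by
  have hle : reducedGraph G ≤ G := SimpleGraph.deleteEdges_le _
  have hedge : ∀ e, IsFreeCutEdge G e → Maximal G.IsClique {v | v ∈ e} := by
    intro e he
    induction e with | _ a b =>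
    have hab : G.Adj a b := he.1
    have h1 : {v | v ∈ s(a, b)} = ({a, b} : Set V) := by ext; simp
    rw [h1]
    refine ⟨by rw [SimpleGraph.isClique_pair]; exact fun _ => hab, fun t ht hst x hx => ?_⟩
    by_contra hn
    simp only [Set.mem_insert_iff, Set.mem_singleton_iff, not_or] at hn
    exact not_adj_of_isBridge he.2.1 (ht (hst (by simp)) hx (Ne.symm hn.1))
      (ht (hst (by simp)) hx (Ne.symm hn.2))
  let f : (Σ R : (reducedGraph G).ConnectedComponent,
      {s : Set R | Maximal R.toSimpleGraph.IsClique s ∧ s.Nontrivial}) ⊕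
        {e | IsFreeCutEdge G e} → {s : Set V | Maximal G.IsClique s} :=
    Sum.elim (fun p => ⟨Subtype.val '' p.2.1, maximal_image_clique p.1 p.2.2.1 p.2.2.2⟩)
      (fun e => ⟨_, hedge e.1 e.2⟩)
  have hf : Function.Injective f := by
    have hne : ∀ p e, f (Sum.inl p) ≠ f (Sum.inr e) := by
      rintro ⟨R, s, hs, hs'⟩ ⟨e, he⟩ h
      have h1 : Subtype.val '' s = {v | v ∈ e} := congrArg Subtype.val h
      induction e with | _ a b =>
      have hab : G.Adj a b := he.1
      obtain ⟨x, hx, hxa⟩ : a ∈ Subtype.val '' s := by rw [h1]; simp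
      obtain ⟨y, hy, hyb⟩ : b ∈ Subtype.val '' s := by rw [h1]; simp
      have h2 : (reducedGraph G).Adj x y := hs.prop hx hy (by
        rintro rfl
        exact hab.ne (hxa.symm.trans hyb))
      rw [hxa, hyb] at h2
      exact ((SimpleGraph.deleteEdges_adj ..).1 h2).2 he
    rintro (⟨R, s, hs, hs'⟩ | e) (⟨R', s', hs₁, hs₁'⟩ | e') h
    · have h1 : Subtype.val '' s = Subtype.val '' s' := congrArg Subtype.val h
      obtain ⟨x, hx⟩ := hs'.nonempty
      obtain ⟨y, hy, hxy⟩ : (x : V) ∈ Subtype.val '' s' := h1 ▸ ⟨x, hx, rfl⟩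
      obtain rfl : R = R' := by
        have hx2 := x.2
        have hy2 := y.2
        rw [hxy] at hy2
        exact hx2.symm.trans hy2
      obtain rfl := Set.image_injective.2 Subtype.val_injective h1
      rfl
    · exact absurd h (hne _ _)
    · exact absurd h.symm (hne _ _)
    · have h1 : {v | v ∈ e.1} = {v | v ∈ e'.1} := congrArg Subtype.val h
      refine congrArg Sum.inr (Subtype.ext (Sym2.ext fun x => ?_))
      exact Set.ext_iff.1 h1 x
  have hcard := Nat.card_le_card_of_injective f hf
  rw [Nat.card_sum, Nat.card_sigma] at hcard
  exact hcard

end Cliques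

/-! ### Regularity of the components and of the whole graph -/

section Assembly

variable {V K : Type*} [Field K]

lemma hasResolutionLE_of_satisfiesConjectureB [Finite V] {G : SimpleGraph V} (hG : G.Connected)
    (h : SatisfiesConjectureB K G) :
    HasResolutionLE (binomialEdgeIdeal K G) (numNontrivialMaximalCliques G) := by
  by_cases hne : G = ⊥
  · subst hne
    rw [binomialEdgeIdeal_bot]
    exact hasResolutionLE_bot.mono (Nat.zero_le _)
  · rw [numNontrivialMaximalCliques_eq hG hne]
    exact hasResolutionLE_of_regularity_le (fun f hf => constantCoeff_of_mem hf) h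

/-- The edges of `H` in the components that belong to `T`. -/
def componentsGraph (H : SimpleGraph V) (T : Finset H.ConnectedComponent) : SimpleGraph V where
  Adj a b := H.Adj a b ∧ H.connectedComponentMk a ∈ T
  symm := ⟨fun _ _ h => ⟨h.1.symm,
    SimpleGraph.ConnectedComponent.connectedComponentMk_eq_of_adj h.1 ▸ h.2⟩⟩
  loopless := ⟨fun _ h => h.1.ne rfl⟩

lemma hasResolutionLE_componentsGraph {H : SimpleGraph V} (n : H.ConnectedComponent → ℕ)
    (h : ∀ R : H.ConnectedComponent,
      HasResolutionLE (binomialEdgeIdeal K R.toSimpleGraph) (n R))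
    (T : Finset H.ConnectedComponent) :
    HasResolutionLE (binomialEdgeIdeal K (componentsGraph H T)) (∑ R ∈ T, n R) := by
  classical
  induction T using Finset.induction_on with
  | empty =>
    have : componentsGraph H ∅ = ⊥ := by
      ext a b
      simp [componentsGraph]
    rw [this, binomialEdgeIdeal_bot]
    exact hasResolutionLE_bot
  | insert R T hR ih =>
    have hgraph : componentsGraph H (insert R T) =
        R.toSimpleGraph.spanningCoe ⊔ componentsGraph H T := by
      ext a b
      rw [SimpleGraph.sup_adj, SimpleGraph.ConnectedComponent.adj_spanningCoe_toSimpleGraph,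
        SimpleGraph.ConnectedComponent.mem_supp_iff]
      simp only [componentsGraph, Finset.mem_insert]
      tauto
    rw [hgraph, Finset.sum_insert hR]
    refine (h R).map_sup ih ?_
    rintro a b hab ⟨⟨x, hx⟩, rfl⟩
    refine hR ?_
    have h1 : H.connectedComponentMk x = R := hx
    exact h1 ▸ hab.2

lemma IsFreeCutEdge.hasResolutionLE [Finite V] {G : SimpleGraph V} {r : ℕ}
    (h : HasResolutionLE (binomialEdgeIdeal K (reducedGraph G)) r) (T : Finset (Sym2 V))
    (hT : ∀ e ∈ T, IsFreeCutEdge G e) :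
    HasResolutionLE (binomialEdgeIdeal K (reducedGraph G ⊔ SimpleGraph.fromEdgeSet T))
      (r + T.card) := by
  classical
  have hle : reducedGraph G ≤ G := SimpleGraph.deleteEdges_le _
  induction T using Finset.induction_on with
  | empty => simpa using h
  | insert e T he ih =>
    have ih := ih fun e' he' => hT e' (Finset.mem_insert_of_mem he')
    have hfree := hT e (Finset.mem_insert_self _ _)
    have hfreeT : ∀ e' ∈ T, IsFreeCutEdge G e' := fun e' he' =>
      hT e' (Finset.mem_insert_of_mem he')
    clear hT
    induction e with | _ i j =>
    have hij : G.Adj i j := hfree.1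
    set H := reducedGraph G ⊔ SimpleGraph.fromEdgeSet T with hH
    have hgraph : reducedGraph G ⊔ SimpleGraph.fromEdgeSet ↑(insert s(i, j) T) =
        H ⊔ SimpleGraph.edge i j := by
      rw [hH, sup_assoc, SimpleGraph.edge, Finset.coe_insert, Set.insert_eq,
        Set.union_comm, SimpleGraph.fromEdgeSet_union]
    have hHG : H ≤ G.deleteEdges {s(i, j)} := by
      intro a b hab
      rw [SimpleGraph.deleteEdges_adj]
      rcases hab with hab | hab
      · refine ⟨hle hab, fun h' => ?_⟩
        rw [Set.mem_singleton_iff] at h'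
        exact ((SimpleGraph.deleteEdges_adj ..).1 hab).2 (h' ▸ hfree)
      · have h1 := ((SimpleGraph.fromEdgeSet_adj _).1 hab).1
        refine ⟨(hfreeT _ h1).1, fun h' => ?_⟩
        rw [Set.mem_singleton_iff] at h'
        exact he (h' ▸ h1)
    -- an edge of `G` missing in `H` is a bridge, so it does not close a triangle
    have hclique : ∀ v ∈ s(i, j), H.IsClique (H.neighborSet v) := by
      intro v hv a ha b hb hab
      have hGab : G.Adj a b := ((SimpleGraph.deleteEdges_adj ..).1
        ((hfree.2.2 v hv).isClique_neighborSet (hHG ha) (hHG hb) hab)).1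
      have hGva : G.Adj v a := ((SimpleGraph.deleteEdges_adj ..).1 (hHG ha)).1
      have hGvb : G.Adj v b := ((SimpleGraph.deleteEdges_adj ..).1 (hHG hb)).1
      refine Or.inl ((SimpleGraph.deleteEdges_adj ..).2 ⟨hGab, fun hfab => ?_⟩)
      exact not_adj_of_isBridge hfab.2.1 hGva.symm hGvb.symm
    rw [hgraph, Finset.card_insert_of_notMem he, ← add_assoc]
    refine ih.sup_edge (fun hr => ?_) (hclique i (by simp)) (hclique j (by simp))
    exact (SimpleGraph.isBridge_iff.1 hfree.2.1) (hr.mono hHG)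

end Assembly

end BinomialEdge

theorem mainTheorem6 {V : Type*} [Finite V] (K : Type*) [Field K] (G : SimpleGraph V)
    (hG : G.Connected)
    (hR : ∀ R : (BinomialEdge.reducedGraph G).ConnectedComponent,
      BinomialEdge.SatisfiesConjectureB K R.toSimpleGraph) :
    BinomialEdge.SatisfiesConjectureB K G := by
  classical
  open BinomialEdge in
  have : Finite (reducedGraph G).ConnectedComponent := Quot.finite _
  have := Fintype.ofFinite (reducedGraph G).ConnectedComponent
  have h1 := hasResolutionLE_componentsGraph (K := K) (H := reducedGraph G)
    (fun R => numNontrivialMaximalCliques R.toSimpleGraph)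
    (fun R => hasResolutionLE_of_satisfiesConjectureB R.connected_toSimpleGraph (hR R)) Finset.univ
  have h2 : componentsGraph (reducedGraph G) Finset.univ = reducedGraph G := by
    ext a b
    simp [componentsGraph]
  rw [h2] at h1
  have hfin : {e | IsFreeCutEdge G e}.Finite := Set.toFinite _
  have h3 := IsFreeCutEdge.hasResolutionLE h1 hfin.toFinset (fun e he => by simpa using he)
  have h4 : reducedGraph G ⊔ SimpleGraph.fromEdgeSet ↑hfin.toFinset = G := by
    rw [Set.Finite.coe_toFinset]
    ext a b
    rw [SimpleGraph.sup_adj, reducedGraph, SimpleGraph.deleteEdges_adj,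
      SimpleGraph.fromEdgeSet_adj]
    refine ⟨?_, fun h => ?_⟩
    · rintro (h | h)
      · exact h.1
      · exact h.1.1
    · by_cases hf : IsFreeCutEdge G s(a, b)
      · exact Or.inr ⟨hf, h.ne⟩
      · exact Or.inl ⟨h, hf⟩
  rw [h4, ← Set.ncard_eq_toFinset_card _ hfin] at h3
  exact (h3.mono (sum_numNontrivialMaximalCliques_add_le G)).regularity_le
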